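/- Let $E$ be a $d$-dimensional real Euclidean space and let $(B,E,\rho)$ be a $d$-dimensional flat-branched semi-simplicial complex: $B$ is a finite $d$-dimensional semi-simplicial set and $\rho:C_1(B,\mathbb Z)\to E$ is a homomorphism that vanishes on boundaries and such that for every $s\in B_d$ the vectors $\rho(e_{d,1}(s)),\dots,\rho(e_{d,d}(s))$ are linearly independent, where $e_{n,i}(s)\in B_1$ denotes the edge of $s\in B_n$ from its vertex $0$ to its vertex $i$. For $s\in B_n$ let $|s|$ be the corresponding open cell of the geometric realization $|B|$ (a vertex being its own interior), and for $x\in|s|$ with barycentric coordinates $(c_0,\dots,c_n)$ put $\alpha_s(x)=\sum_{i=1}^n c_i\,\rho(e_{n,i}(s))\in E$. A continuous map $f:E\to|B|$ is an isometric winding if for every simplex $s$ the restriction $f^{-1}(|s|)\to|s|$ is a covering map (possibly with empty fibres) and $\alpha_s\circ f$ is a translation on each connected component of $f^{-1}(|s|)$. Let $f_0:E\to|B|$ be an isometric winding. Put $(T_tf)(y)=f(y-t)$ for $t\in E$, let $\mathbb X=\overline{\{T_tf_0: t\in E\}}$ be the hull of $f_0$ (closure in the compact-open topology of $C(E,|B|)$),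 and let $\mu$ be a translation invariant Borel probability measure on $\mathbb X$. For $x\in|B|$ and a Schwartz function $\varphi\in\mathcal S(E)$ put $$\Gamma_x(\varphi)(f)=\sum_{y\in f^{-1}(x)}\varphi(-y)\quad(f\in\mathbb X),\qquad \widehat\varphi(k)=\int_E\varphi(y)\,e^{-2\pi i\,k\cdot y}\,dy\quad(k\in E^*).$$ Let $k\in E^*$ be an eigenvalue ($k\in\mathcal E$), that is, there is a non-zero $\psi\in L^2(\mathbb X,\mu)$ with $T_t\psi=e^{2\pi i\,k\cdot t}\psi$ for all $t\in E$, where $(T_t\psi)(f)=\psi(T_{-t}f)$; and let $\psi_k$ be such an eigenfunction with $\|\psi_k\|=1$. (Inner products are antilinear in the first argument.) Then $\Gamma_x(\varphi)\in L^2(\mathbb X,\mu)$ for all $x$ and $\varphi$, and there is exactly one function $a_k:|B|\to\mathbb C$, the partial diffraction amplitude, such that $$\langle\psi_k,\Gamma_x(\varphi)\rangle=a_k(x)\,\widehat\varphi(k)\qquad\text{for all }x\in|B|,\ \varphi\in\mathcal S(E).$$ It has the following properties. 1. Let $x_1,\dots,x_m\in|B|$ and let $\zeta=(\zeta_{pq})$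 be a matrix-valued diffraction measure of this decoration, that is, a tempered positive semi-definite $m\times m$-matrix-valued Borel measure on $E^*$ with $\sum_{p,q}\overline{w_p}w_q\langle\Gamma_{x_p}(\varphi_1),\Gamma_{x_q}(\varphi_2)\rangle=\sum_{p,q}\overline{w_p}w_q\int_{E^*}\overline{\widehat{\varphi_1}}\,\widehat{\varphi_2}\,d\zeta_{pq}$ for all $w\in\mathbb C^m$ and $\varphi_1,\varphi_2\in\mathcal S(E)$. Let $\Theta:L^2(E^*,\zeta;\mathbb C^m)\to L^2(\mathbb X,\mu)$ be a linear isometric embedding with $\Theta(\widehat\varphi\otimes e_p)=\Gamma_{x_p}(\varphi)$ for all $\varphi$ and $p$. Then $1_{\{k\}}\otimes e_p\in L^2(E^*,\zeta;\mathbb C^m)$ and $\langle\psi_k,\Theta(1_{\{k\}}\otimes e_p)\rangle=a_k(x_p)$ for $1\le p\le m$. 2. $a_k\in\mathcal F_{(k),\bullet}=\bigoplus_{n=0}^d\mathcal F_{(k),n}$, a subspace of the space of all functions $|B|\to\mathbb C$, where $\mathcal F_{(k),n}$ is the span of the functions $Y_s$, $s\in B_n$, given by $Y_s(x)=\exp(-2\pi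 i\,k\cdot\alpha_s(x))$ for $x\in|s|$ and $Y_s(x)=0$ for $x\notin|s|$. 3. For every simplex $s$ there is a constant $c\in\mathbb C$ with $a_k(x)=c\,\exp(-2\pi i\,k\cdot\alpha_s(x))$ for all $x\in|s|$. -/

import Mathlib

open CategoryTheory MeasureTheory
open scoped SchwartzMap Matrix ComplexOrder

universe u v

noncomputable section

/-! ### Semi-simplicial sets and their geometric realization -/

/-- A semi-simplicial set: a contravariant functor from the category of the finite ordered sets
`{0 < 1 < ... < n}` and order preserving injections to the category of sets. -/
abbrev SemiSimplicialSet : Type (u + 1) := SemiSimplexCategoryᵒᵖ ⥤ Type u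

namespace SemiSimplicialSet

variable (B : SemiSimplicialSet.{u})

/-- The set `B_n` of `n`-simplices. -/
abbrev cell (n : ℕ) : Type u := B.obj (Opposite.op (SemiSimplexCategory.mk n))

variable {B}

/-- The functorial image `B_n → B_m` of an order preserving injection `[m] → [n]`. -/
def pull {m n : ℕ} (θ : Fin (m + 1) ↪o Fin (n + 1)) (s : B.cell n) : B.cell m :=
  B.map (SemiSimplexCategory.homEquiv (n := SemiSimplexCategory.mk m)
    (m := SemiSimplexCategory.mk n) |>.symm θ).op s

/-- The face map `δ_{n+1,i} : B_{n+1} → B_n`. -/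
def face {n : ℕ} (i : Fin (n + 2)) (s : B.cell (n + 1)) : B.cell n :=
  pull (Fin.succAboveOrderEmb i) s

/-- The injection `[1] → [n]`, `0 ↦ 0`, `1 ↦ i` for `i ∈ {1, ..., n}`; the index `i` is written
as `j + 1` with `j : Fin n`. -/
def edgeEmb {n : ℕ} (j : Fin n) : Fin (1 + 1) ↪o Fin (n + 1) :=
  OrderEmbedding.ofStrictMono ![0, j.succ] (by
    intro a b hab
    fin_cases a <;> fin_cases b <;> simp_all)

/-- The reference edges `e_{n,1}(s), ..., e_{n,n}(s)` of an `n`-simplex `s`; `refEdge s j` is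
`e_{n,j+1}(s)`. -/
def refEdge {n : ℕ} (s : B.cell n) (j : Fin n) : B.cell 1 := pull (edgeEmb j) s

variable (B) in
/-- The boundary operator `∂_{n+1} : C_{n+1}(B, ℤ) → C_n(B, ℤ)`. -/
def boundary (n : ℕ) : (B.cell (n + 1) →₀ ℤ) →+ (B.cell n →₀ ℤ) :=
  ∑ i : Fin (n + 2), ((-1 : ℤ) ^ (i : ℕ)) • Finsupp.mapDomain.addMonoidHom (face i)

variable (B) in
/-- A point of the disjoint union of the closed standard simplices indexed by `B_•`. -/
abbrev PreRealization : Type u :=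
  Σ c : (Σ n, B.cell n), stdSimplex ℝ (Fin (c.1 + 1))

/-- The gluing relation `(θ^* s, p) ∼ (s, θ_* p)`. -/
inductive Glue : B.PreRealization → B.PreRealization → Prop
  | glue {m n : ℕ} (θ : Fin (m + 1) ↪o Fin (n + 1)) (s : B.cell n)
      (p : stdSimplex ℝ (Fin (m + 1))) :
      Glue ⟨⟨m, pull θ s⟩, p⟩ ⟨⟨n, s⟩, stdSimplex.map θ p⟩

variable (B) in
/-- The geometric realization `|B|`, with the quotient topology. -/
def Realization : Type u := Quot (Glue (B := B))

instance : TopologicalSpace B.Realization :=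
  inferInstanceAs (TopologicalSpace (Quot (Glue (B := B))))

/-- The characteristic map of the closed simplex indexed by `s`. -/
def charMap {n : ℕ} (s : B.cell n) (p : stdSimplex ℝ (Fin (n + 1))) : B.Realization :=
  Quot.mk _ ⟨⟨n, s⟩, p⟩

/-- The interior of the standard `n`-simplex (a point is its own interior). -/
def openSimplex (n : ℕ) : Set (stdSimplex ℝ (Fin (n + 1))) := {p | ∀ i, 0 < p i}

/-- The open cell `|s| ⊆ |B|`. -/
def openCell {n : ℕ} (s : B.cell n) : Set B.Realization := charMap s '' openSimplex n

/-- The barycentric coordinates of a point of `|s|`. -/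
def bary {n : ℕ} (s : B.cell n) : B.Realization → stdSimplex ℝ (Fin (n + 1)) :=
  Function.invFunOn (charMap s) (openSimplex n)

theorem pull_refl {n : ℕ} (s : B.cell n) : pull (RelEmbedding.refl _) s = s := by
  have h : (SemiSimplexCategory.homEquiv (n := SemiSimplexCategory.mk n)
      (m := SemiSimplexCategory.mk n)).symm (RelEmbedding.refl _) = 𝟙 _ := by
    apply SemiSimplexCategory.hom_ext; simp
  simp [pull, h]

theorem pull_trans {l m n : ℕ} (η : Fin (l + 1) ↪o Fin (m + 1)) (θ : Fin (m + 1) ↪o Fin (n + 1))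
    (s : B.cell n) : pull (RelEmbedding.trans η θ) s = pull η (pull θ s) := by
  have h : (SemiSimplexCategory.homEquiv (n := SemiSimplexCategory.mk l)
      (m := SemiSimplexCategory.mk n)).symm (RelEmbedding.trans η θ) =
      (SemiSimplexCategory.homEquiv (n := SemiSimplexCategory.mk l)
        (m := SemiSimplexCategory.mk m)).symm η ≫
      (SemiSimplexCategory.homEquiv (n := SemiSimplexCategory.mk m)
        (m := SemiSimplexCategory.mk n)).symm θ := by
    apply SemiSimplexCategory.hom_ext; simp
  simp [pull, h]

/-! The barycentric coordinates on an open cell are well defined. -/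

theorem map_apply_emb {m n : ℕ} (θ : Fin (m + 1) ↪o Fin (n + 1))
    (p : stdSimplex ℝ (Fin (m + 1))) (i : Fin (m + 1)) : stdSimplex.map θ p (θ i) = p i := by
  classical
  rw [stdSimplex.map_coe, FunOnFinite.linearMap_apply_apply]
  rw [Finset.sum_eq_single i] <;> simp +contextual

theorem map_apply_ne {m n : ℕ} (θ : Fin (m + 1) ↪o Fin (n + 1))
    (p : stdSimplex ℝ (Fin (m + 1))) (j : Fin (n + 1)) (hj : j ∉ Set.range θ) :
    stdSimplex.map θ p j = 0 := by
  classical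
  rw [stdSimplex.map_coe, FunOnFinite.linearMap_apply_apply]
  apply Finset.sum_eq_zero
  intro i hi
  exact absurd ⟨i, (Finset.mem_filter.1 hi).2⟩ hj

/-- `x` lies on the face of its simplex which is `y.1`, at the position `y.2`. -/
def OnFace (x y : B.PreRealization) : Prop :=
  ∃ θ : Fin (y.1.1 + 1) ↪o Fin (x.1.1 + 1),
    pull θ x.1.2 = y.1.2 ∧ stdSimplex.map θ y.2 = x.2

theorem onFace_glue {x x' y : B.PreRealization} (hy : ∀ i, 0 < y.2 i) (h : Glue x x') :
    OnFace x y ↔ OnFace x' y := by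
  obtain ⟨⟨l, r⟩, q⟩ := y
  cases h with
  | @glue m n η s p =>
    constructor
    · rintro ⟨θ, h1, h2⟩
      refine ⟨RelEmbedding.trans θ η, ?_, ?_⟩
      · rw [pull_trans]; exact h1
      · dsimp only at h2 ⊢
        rw [← h2, stdSimplex.map_comp_apply]; rfl
    · rintro ⟨θ, h1, h2⟩
      dsimp only at θ h1 h2 hy
      have hr : ∀ i, ∃ j, η j = θ i := by
        intro i
        by_contra hc
        have h3 := map_apply_ne η p (θ i) (fun ⟨j, hj⟩ => hc ⟨j, hj⟩)
        rw [← h2, map_apply_emb] at h3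
        exact (hy i).ne' h3
      choose g hg using hr
      let θ' : Fin (l + 1) ↪o Fin (m + 1) := OrderEmbedding.ofMapLEIff g (by
        intro a b; rw [← η.le_iff_le, hg, hg, θ.le_iff_le])
      have hθ : RelEmbedding.trans θ' η = θ := by
        ext i; exact congrArg _ (hg i)
      refine ⟨θ', ?_, ?_⟩
      · dsimp only; rw [← pull_trans, hθ]; exact h1
      · dsimp only
        apply stdSimplex.ext
        funext j
        rw [← map_apply_emb η p j, ← h2, ← hθ, ← map_apply_emb η (stdSimplex.map θ' q) j,
          stdSimplex.map_comp_apply]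
        rfl

theorem onFace_of_eq {x x' y : B.PreRealization} (hy : ∀ i, 0 < y.2 i)
    (h : Quot.mk Glue x = Quot.mk Glue x') : OnFace x y ↔ OnFace x' y := by
  have h' := Quot.eqvGen_exact h
  clear h
  induction h' with
  | rel _ _ h => exact onFace_glue hy h
  | refl => rfl
  | symm _ _ _ ih => exact ih.symm
  | trans _ _ _ _ _ ih1 ih2 => exact ih1.trans ih2

/-- Two interior points of closed simplices which are identified in `|B|` are equal. -/
theorem eq_of_interior {x y : B.PreRealization} (hx : ∀ i, 0 < x.2 i) (hy : ∀ i, 0 < y.2 i)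
    (h : Quot.mk Glue x = Quot.mk Glue y) : x = y := by
  have h0 : OnFace y y := ⟨RelEmbedding.refl _, pull_refl _, stdSimplex.map_id_apply _⟩
  obtain ⟨θ, h1, h2⟩ := (onFace_of_eq hy h).2 h0
  obtain ⟨⟨m, s⟩, p⟩ := x
  obtain ⟨⟨n, r⟩, q⟩ := y
  dsimp only at θ h1 h2 hx hy
  have hs : Function.Surjective θ := by
    intro j
    by_contra hc
    have := map_apply_ne θ q j hc
    rw [h2] at this
    exact (hx j).ne' this
  have hc : n = m := by
    have := Fintype.card_of_bijective ⟨θ.injective, hs⟩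
    simpa using this
  subst hc
  have hθ : θ = RelEmbedding.refl _ := by
    have := Subsingleton.elim
      (RelIso.ofSurjective θ hs : Fin (n + 1) ≃o Fin (n + 1)) (OrderIso.refl _)
    ext i
    exact congrArg (fun e : Fin (n + 1) ≃o Fin (n + 1) => ((e i : Fin (n + 1)) : ℕ)) this
  subst hθ
  rw [pull_refl] at h1
  have h3 : q = p := by rw [← h2]; exact (stdSimplex.map_id_apply _).symm
  subst h1; subst h3; rfl

theorem injOn_charMap {n : ℕ} (s : B.cell n) : Set.InjOn (charMap s) (openSimplex n) := by
  intro p hp q hq h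
  have := eq_of_interior (x := ⟨⟨n, s⟩, p⟩) (y := ⟨⟨n, s⟩, q⟩) hp hq h
  simpa using this

theorem bary_charMap {n : ℕ} (s : B.cell n) {p : stdSimplex ℝ (Fin (n + 1))}
    (hp : p ∈ openSimplex n) : bary s (charMap s p) = p :=
  (injOn_charMap s).leftInvOn_invFunOn hp

end SemiSimplicialSet

/-! ### Flat-branched complexes and isometric windings -/

/-- A flat-branched semi-simplicial complex over the Euclidean space `E`; its dimension is the
dimension of `E`. -/
structure FBSComplex (E : Type v) [NormedAddCommGroup E] [InnerProductSpace ℝ E]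
    [FiniteDimensional ℝ E] where
  /-- the underlying semi-simplicial set -/
  B : SemiSimplicialSet.{u}
  finite_cell : ∀ n, Finite (B.cell n)
  nonempty_top : Nonempty (B.cell (Module.finrank ℝ E))
  isEmpty_above : ∀ n, Module.finrank ℝ E < n → IsEmpty (B.cell n)
  /-- the homomorphism `C_1(B, ℤ) → E` -/
  ρ : (B.cell 1 →₀ ℤ) →+ E
  ρ_boundary : ∀ c : B.cell 2 →₀ ℤ, ρ (B.boundary 1 c) = 0
  linearIndependent : ∀ s : B.cell (Module.finrank ℝ E),
    LinearIndependent ℝ fun j => ρ (Finsupp.single (SemiSimplicialSet.refEdge s j) 1)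

namespace FBSComplex

open SemiSimplicialSet

variable {E : Type v} [NormedAddCommGroup E] [InnerProductSpace ℝ E] [FiniteDimensional ℝ E]
  (X : FBSComplex.{u, v} E)

/-- The prototile space `|B|`. -/
abbrev Space : Type u := X.B.Realization

variable {X}

/-- The vector of `E` carried by the reference edge `e_{n,j+1}(s)`. -/
def edgeVec {n : ℕ} (s : X.B.cell n) (j : Fin n) : E := X.ρ (Finsupp.single (refEdge s j) 1)

/-- The map `α_s`, meaningful on `|s|`: the point of `|s|` with barycentric coordinates
`(c_0, ..., c_n)` goes to `∑_{i ≥ 1} c_i ρ(e_{n,i}(s))`. -/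
def alpha {n : ℕ} (s : X.B.cell n) (x : X.Space) : E := ∑ j : Fin n, bary s x j.succ • edgeVec s j

theorem alpha_charMap {n : ℕ} (s : X.B.cell n) {p : stdSimplex ℝ (Fin (n + 1))}
    (hp : p ∈ openSimplex n) : alpha s (charMap s p) = ∑ j : Fin n, p j.succ • edgeVec s j := by
  simp only [alpha, bary_charMap s hp]

/-- Isometric windings of the complex. -/
structure IsIsometricWinding (f : C(E, X.Space)) : Prop where
  isCoveringMap : ∀ (n : ℕ) (s : X.B.cell n), IsCoveringMap ((openCell s).restrictPreimage f)
  translation : ∀ (n : ℕ) (s : X.B.cell n), ∀ y ∈ f ⁻¹' openCell s, ∃ v : E,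
    ∀ z ∈ connectedComponentIn (f ⁻¹' openCell s) y, alpha s (f z) = z + v

/-! ### The hull -/

/-- `T_t f : y ↦ f (y - t)`. -/
def translate (t : E) (f : C(E, X.Space)) : C(E, X.Space) :=
  f.comp ⟨fun y => y - t, by fun_prop⟩

/-- The hull: the closure of the orbit of `f₀` in the compact-open topology. -/
def hull (f₀ : C(E, X.Space)) : Set C(E, X.Space) :=
  closure (Set.range fun t : E => translate t f₀)

theorem translate_mem_hull {f₀ f : C(E, X.Space)} (t : E) (hf : f ∈ hull f₀) :
    translate t f ∈ hull f₀ := by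
  refine map_mem_closure (ContinuousMap.continuous_precomp _) hf ?_
  rintro _ ⟨r, rfl⟩
  refine ⟨r + t, ?_⟩
  ext y
  simp [translate, sub_sub, add_comm]

/-- The action of the translation by `t` on the hull. -/
def hullTranslate {f₀ : C(E, X.Space)} (t : E) (f : hull f₀) : hull f₀ :=
  ⟨translate t f, translate_mem_hull t f.2⟩

/-! ### Eigenfunctions and partial amplitudes -/

/-- `Γ_x(φ)`, as a function on the hull. -/
def Gamma {f₀ : C(E, X.Space)} (x : X.Space) (φ : 𝓢(E, ℂ)) (f : hull f₀) : ℂ :=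
  ∑' y : (f : C(E, X.Space)) ⁻¹' {x}, φ (-(y : E))

variable {f₀ : C(E, X.Space)} [MeasurableSpace (hull f₀)]

/-- `T_t ψ = exp(2 π i k · t) ψ` for all `t`, where `(T_t ψ)(f) = ψ (T_{-t} f)`. -/
def IsEigenfunction (μ : Measure (hull f₀)) (k : StrongDual ℝ E) (ψ : Lp ℂ 2 μ) : Prop :=
  ∀ t : E, (fun f => ψ (hullTranslate (-t) f)) =ᵐ[μ]
    fun f => Complex.exp (2 * Real.pi * Complex.I * (k t : ℂ)) * ψ f

/-- The pure point part `𝓔` of the dynamical spectrum. -/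
def pointSpectrum (μ : Measure (hull f₀)) : Set (StrongDual ℝ E) :=
  {k | ∃ ψ : Lp ℂ 2 μ, ψ ≠ 0 ∧ IsEigenfunction μ k ψ}

variable [MeasurableSpace E] [BorelSpace E]

/-- The Fourier transform `φ̂(k) = ∫ φ(y) exp(-2 π i k · y) dy`. -/
def fourierAt (φ : 𝓢(E, ℂ)) (k : StrongDual ℝ E) : ℂ :=
  ∫ y : E, φ y * Complex.exp (-(2 * Real.pi * Complex.I * (k y : ℂ)))

/-- `a` is the function of partial diffraction amplitudes attached to the eigenfunction `ψ` with
eigenvalue `k`: `⟨ψ, Γ_x(φ)⟩ = a(x) φ̂(k)` for all `x` and `φ`. -/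
def IsPartialAmplitude (μ : Measure (hull f₀)) (k : StrongDual ℝ E) (ψ : Lp ℂ 2 μ)
    (a : X.Space → ℂ) : Prop :=
  ∀ (x : X.Space) (φ : 𝓢(E, ℂ)), ∃ h : MemLp (Gamma x φ) 2 μ,
    inner ℂ ψ (h.toLp (Gamma x φ)) = a x * fourierAt φ k

end FBSComplex

/-! ### Matrix-valued measures on the dual space and the diffraction measure -/

/-- A tempered positive semi-definite matrix-valued Borel measure `ζ` on `E^*`, given by its trace
measure and its density with respect to the trace measure, so that
`ζ(A) = ∫_A density d(trace)`. -/
structure MatrixMeasure (E : Type v) [NormedAddCommGroup E] [InnerProductSpace ℝ E]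
    [FiniteDimensional ℝ E] (m : ℕ) where
  /-- the trace measure -/
  base : Measure (StrongDual ℝ E)
  temperate : base.HasTemperateGrowth
  /-- the density -/
  density : StrongDual ℝ E → Matrix (Fin m) (Fin m) ℂ
  measurable_density : ∀ p q, Measurable fun ξ => density ξ p q
  posSemidef : ∀ ξ, (density ξ).PosSemidef
  trace_eq_one : ∀ᵐ ξ ∂base, (density ξ).trace = 1

namespace MatrixMeasure

variable {E : Type v} [NormedAddCommGroup E] [InnerProductSpace ℝ E] [FiniteDimensional ℝ E]
  {m : ℕ}

/-- The integrand of the sesquilinear form of `L²(E^*, ζ; ℂ^m)`. -/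
def form (ζ : MatrixMeasure E m) (g h : StrongDual ℝ E → Fin m → ℂ) (ξ : StrongDual ℝ E) : ℂ :=
  star (g ξ) ⬝ᵥ (ζ.density ξ *ᵥ h ξ)

theorem measurable_form (ζ : MatrixMeasure E m) {g h : StrongDual ℝ E → Fin m → ℂ}
    (hg : Measurable g) (hh : Measurable h) : Measurable (ζ.form g h) := by
  have h1 := ζ.measurable_density
  have h2 : ∀ p, Measurable fun ξ => g ξ p := fun p => (measurable_pi_apply p).comp hg
  have h3 : ∀ p, Measurable fun ξ => h ξ p := fun p => (measurable_pi_apply p).comp hh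
  unfold form dotProduct Matrix.mulVec dotProduct
  refine Finset.measurable_sum _ fun p _ => ?_
  refine Measurable.mul ?_ (Finset.measurable_sum _ fun q _ => (h1 p q).mul (h3 q))
  exact Complex.continuous_conj.measurable.comp (h2 p)

/-- The functions square-integrable with respect to `ζ`. -/
def L2 (ζ : MatrixMeasure E m) : Submodule ℂ (StrongDual ℝ E → Fin m → ℂ) where
  carrier := {g | Measurable g ∧ Integrable (ζ.form g g) ζ.base}
  zero_mem' := ⟨measurable_const, by
    have : ζ.form 0 0 = fun _ => 0 := by funext ξ; simp [form]
    rw [this]; exact integrable_zero _ _ _⟩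
  add_mem' := by
    rintro g h ⟨hg, hg'⟩ ⟨hh, hh'⟩
    refine ⟨hg.add hh, Integrable.mono' ((hg'.norm.add hh'.norm).const_mul 2)
      (ζ.measurable_form (hg.add hh) (hg.add hh)).aestronglyMeasurable
      (Filter.Eventually.of_forall fun ξ => ?_)⟩
    have hpos : ∀ w : Fin m → ℂ, (‖star w ⬝ᵥ (ζ.density ξ *ᵥ w)‖ : ℂ) =
        star w ⬝ᵥ (ζ.density ξ *ᵥ w) :=
      fun w => Complex.norm_of_nonneg' ((ζ.posSemidef ξ).dotProduct_mulVec_nonneg w)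
    have key : star (g ξ + h ξ) ⬝ᵥ (ζ.density ξ *ᵥ (g ξ + h ξ)) +
        star (g ξ - h ξ) ⬝ᵥ (ζ.density ξ *ᵥ (g ξ - h ξ)) =
        2 * (star (g ξ) ⬝ᵥ (ζ.density ξ *ᵥ g ξ) + star (h ξ) ⬝ᵥ (ζ.density ξ *ᵥ h ξ)) := by
      simp only [star_add, star_sub, Matrix.mulVec_add, Matrix.mulVec_sub, dotProduct_add,
        dotProduct_sub, add_dotProduct, sub_dotProduct]
      ring
    rw [← hpos (g ξ + h ξ), ← hpos (g ξ - h ξ), ← hpos (g ξ), ← hpos (h ξ)] at key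
    norm_cast at key
    have := norm_nonneg (star (g ξ - h ξ) ⬝ᵥ (ζ.density ξ *ᵥ (g ξ - h ξ)))
    simp only [form, Pi.add_apply]
    linarith
  smul_mem' := by
    rintro c g ⟨hg, hg'⟩
    refine ⟨hg.const_smul c, ?_⟩
    have : ζ.form (c • g) (c • g) = fun ξ => (star c * c) * ζ.form g g ξ := by
      funext ξ
      simp [form, Matrix.mulVec_smul]
      ring
    rw [this]
    exact hg'.const_mul _

/-- The inner product of `L²(E^*, ζ; ℂ^m)`, antilinear in the first argument. -/
def innerL2 (ζ : MatrixMeasure E m) (g h : ζ.L2) : ℂ :=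
  ∫ ξ, ζ.form (g : StrongDual ℝ E → Fin m → ℂ) h ξ ∂ζ.base

end MatrixMeasure

namespace FBSComplex

variable {E : Type v} [NormedAddCommGroup E] [InnerProductSpace ℝ E] [FiniteDimensional ℝ E]
  [MeasurableSpace E] [BorelSpace E] {X : FBSComplex.{u, v} E}
  {f₀ : C(E, X.Space)} [MeasurableSpace (hull f₀)] {m : ℕ}

/-- `u ⊗ e_p` for a scalar function `u` on `E^*`. -/
def tensorBasis (u : StrongDual ℝ E → ℂ) (p : Fin m) : StrongDual ℝ E → Fin m → ℂ :=
  fun ξ => Pi.single p (u ξ)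

/-- `ζ` is the matrix-valued diffraction measure of the decoration `x_1, ..., x_m`: for all weights
`w`, the measure `η = ∑ w̄_p w_q ζ_{pq}` represents the form
`∑ w̄_p w_q ⟨Γ_{x_p}(φ₁), Γ_{x_q}(φ₂)⟩`. -/
def IsDiffractionMeasure (μ : Measure (hull f₀)) (x : Fin m → X.Space)
    (ζ : MatrixMeasure E m) : Prop :=
  ∀ (w : Fin m → ℂ) (φ₁ φ₂ : 𝓢(E, ℂ)),
    (∑ p, ∑ q, star (w p) * w q *
      ∫ f, star (Gamma (x p) φ₁ f) * Gamma (x q) φ₂ f ∂μ) =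
    ∫ ξ, star (fourierAt φ₁ ξ) * fourierAt φ₂ ξ *
      (∑ p, ∑ q, star (w p) * w q * ζ.density ξ p q) ∂ζ.base

/-- `Θ : L²(E^*, ζ; ℂ^m) → L²(hull, μ)` is the isometric embedding with
`Θ(φ̂ ⊗ e_p) = Γ_{x_p}(φ)`. -/
structure IsDiffractionEmbedding (μ : Measure (hull f₀)) (x : Fin m → X.Space)
    (ζ : MatrixMeasure E m) (Θ : ζ.L2 →ₗ[ℂ] Lp ℂ 2 μ) : Prop where
  inner_map : ∀ g h : ζ.L2, inner ℂ (Θ g) (Θ h) = ζ.innerL2 g h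
  map_schwartz : ∀ (φ : 𝓢(E, ℂ)) (p : Fin m) (hφ : tensorBasis (fourierAt φ) p ∈ ζ.L2),
    Θ ⟨tensorBasis (fourierAt φ) p, hφ⟩ =ᵐ[μ] Gamma (x p) φ

/-! ### The spaces of functions on the prototile space -/

open Classical in
/-- The function `Y_s`: `exp(-2 π i k · α_s(x))` on `|s|` and `0` elsewhere. -/
def Y (k : StrongDual ℝ E) {n : ℕ} (s : X.B.cell n) (x : X.Space) : ℂ :=
  if x ∈ SemiSimplicialSet.openCell s then
    Complex.exp (-(2 * Real.pi * Complex.I * (k (alpha s x) : ℂ)))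
  else 0

variable (X) in
/-- `𝓕_{(k),n}`, the span of the functions `Y_s`, `s ∈ B_n`. -/
def F (k : StrongDual ℝ E) (n : ℕ) : Submodule ℂ (X.Space → ℂ) :=
  Submodule.span ℂ (Set.range fun s : X.B.cell n => Y k s)

variable (X) in
/-- `𝓕_{(k),•} = 𝓕_{(k),0} + ... + 𝓕_{(k),d}`, inside the space of all functions on `|B|`. -/
def FTotal (k : StrongDual ℝ E) : Submodule ℂ (X.Space → ℂ) :=
  ⨆ n : Fin (Module.finrank ℝ E + 1), F X k n

end FBSComplex

end

/-! An isometric winding is rigid over cells. Lifting a segment of an open cell through the covering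
and comparing with `α_s` shows that `f y = x` forces `f (y + α_s x' - α_s x) = x'` for `x, x'` in
`|s|` (`IsIsometricWinding.apply_add_affPos`). Preimages of cells of dimension below `d` lie in
countably many translates of proper subspaces, so almost every point lies over a top cell; by
compactness every point then lies in a closed tile on which `f` is a characteristic map
(`IsIsometricWinding.isTiled`). Being tiled is a closed, translation invariant condition, so it
holds on the whole hull (`IsTiled.of_mem_hull`), and it gives back the rigidity over all cells
(`IsTiled.apply_add_affPos`).

Tiles have uniform inner and outer size, so sums over `f⁻¹(x)` of a rapidly decreasing function are
bounded uniformly on the hull (`exists_sum_weight_le`); with semicontinuity in `f` this puts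
`Γ_x(φ)` in `L²`. Invariance of `μ` and the eigenvalue equation turn a translation by `t` into the
factor `exp(-2πi k·t)` on `c(φ) = ⟨ψ, Γ_x(φ)⟩`. Integrated against a Schwartz function `φ`, this
says that `φ̂(k) c(χ)` is the coefficient of the convolution of `φ` and `χ`, which is symmetric, so
`φ̂(k) c(χ) = χ̂(k) c(φ)` (`fourierAt_mul_coeff_comm`). If `χ̂(k) = 1`, then `a_k(x) = c(χ)` works
and is forced.

Fibres over two points of `|s|` are translates of each other, which gives the phase of `a_k` along
`|s|` (`coeff_openCell`); as the finitely many open cells partition `|B|`, `a_k` is a combination of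
the `Y_s`. For the diffraction embedding, Fourier transforms that are bumps shrinking to `k`
converge to `1_{k} ⊗ e_p` in `L²(ζ)`, while their images all have coefficient `a_k(x_p)`
(`IsPartialAmplitude.inner_embedding`). -/

noncomputable section

/-! ### Open cells and the Hausdorff property of the realization -/

namespace SemiSimplicialSet

variable {B : SemiSimplicialSet.{u}}

theorem quot_eq_of_onFace {z y : B.PreRealization} (h : OnFace z y) :
    Quot.mk Glue z = Quot.mk Glue y := by
  obtain ⟨⟨n, s⟩, p⟩ := z
  obtain ⟨⟨l, r⟩, q⟩ := y
  obtain ⟨θ, h1, h2⟩ := h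
  dsimp only at θ h1 h2
  rw [← h1, ← h2]
  exact (Quot.sound (Glue.glue θ s q)).symm

/-- Every point of a closed simplex is an interior point of a face. -/
theorem exists_interior_onFace (z : B.PreRealization) :
    ∃ y : B.PreRealization, (∀ i, 0 < y.2 i) ∧ OnFace z y := by
  classical
  obtain ⟨⟨n, s⟩, p⟩ := z
  -- The face is spanned by the support of `p`, enumerated increasingly.
  let S : Finset (Fin (n + 1)) := Finset.univ.filter fun i => 0 < p i
  have hsum : ∑ i ∈ S, p i = 1 := by
    rw [← stdSimplex.sum_eq_one p]
    refine Finset.sum_subset (Finset.subset_univ _) fun i _ hi => ?_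
    have h1 := stdSimplex.zero_le p i
    have h2 : ¬ 0 < p i := by simpa [S] using hi
    linarith
  have hne : S.Nonempty := by
    by_contra hc
    rw [Finset.not_nonempty_iff_eq_empty] at hc
    simp [hc] at hsum
  obtain ⟨m, hm⟩ : ∃ m, S.card = m + 1 := ⟨S.card - 1, by have := hne.card_pos; omega⟩
  let θ := S.orderEmbOfFin hm
  have hθ : ∀ i, 0 < p (θ i) := fun i => by
    exact (Finset.mem_filter.1 (S.orderEmbOfFin_mem hm i)).2
  have hθsum : ∑ i, p (θ i) = 1 := by
    rw [← hsum, ← Finset.map_orderEmbOfFin_univ S hm, Finset.sum_map]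
    rfl
  let q : stdSimplex ℝ (Fin (m + 1)) := ⟨fun i => p (θ i), fun i => (hθ i).le, hθsum⟩
  refine ⟨⟨⟨m, pull θ s⟩, q⟩, hθ, θ, rfl, ?_⟩
  apply stdSimplex.ext
  funext j
  by_cases hj : j ∈ Set.range θ
  · obtain ⟨i, rfl⟩ := hj
    exact map_apply_emb θ q i
  · refine (map_apply_ne θ q j hj).trans ?_
    have h1 := stdSimplex.zero_le p j
    have h2 : ¬ 0 < p j := fun h => hj (by
      rw [Finset.range_orderEmbOfFin]
      simpa [S] using h)
    exact le_antisymm h1 (not_lt.1 h2)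

theorem exists_mem_openCell (x : B.Realization) : ∃ (n : ℕ) (s : B.cell n), x ∈ openCell s := by
  obtain ⟨z, rfl⟩ := Quot.exists_rep x
  obtain ⟨⟨⟨n, s⟩, p⟩, hy, h⟩ := exists_interior_onFace z
  exact ⟨n, s, p, hy, (quot_eq_of_onFace h).symm⟩

theorem eq_of_mem_openCell {m n : ℕ} {s : B.cell m} {r : B.cell n} {x : B.Realization}
    (hs : x ∈ openCell s) (hr : x ∈ openCell r) :
    (⟨m, s⟩ : Σ n, B.cell n) = ⟨n, r⟩ := by
  obtain ⟨p, hp, rfl⟩ := hs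
  obtain ⟨q, hq, h⟩ := hr
  have := eq_of_interior (x := ⟨⟨m, s⟩, p⟩) (y := ⟨⟨n, r⟩, q⟩) hp hq h.symm
  exact congrArg Sigma.fst this

/-- A point of a closed simplex lying over a point of `|s|` is in the interior of a face `s`. -/
theorem exists_face_of_charMap_eq {m n : ℕ} {s : B.cell m} {r : B.cell n}
    {p : stdSimplex ℝ (Fin (m + 1))} (hp : p ∈ openSimplex m) {q : stdSimplex ℝ (Fin (n + 1))}
    (h : charMap r q = charMap s p) :
    ∃ θ : Fin (m + 1) ↪o Fin (n + 1), pull θ r = s ∧ stdSimplex.map θ p = q :=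
  (onFace_of_eq (x := ⟨⟨n, r⟩, q⟩) (x' := ⟨⟨m, s⟩, p⟩) (y := ⟨⟨m, s⟩, p⟩) hp h).2
    ⟨RelEmbedding.refl _, pull_refl _, stdSimplex.map_id_apply _⟩

theorem charMap_map {m n : ℕ} (θ : Fin (m + 1) ↪o Fin (n + 1)) (r : B.cell n)
    (p : stdSimplex ℝ (Fin (m + 1))) : charMap r (stdSimplex.map θ p) = charMap (pull θ r) p :=
  (Quot.sound (Glue.glue θ r p)).symm

instance finite_orderEmbedding (a b : ℕ) : Finite (Fin a ↪o Fin b) := DFunLike.finite _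

/-- A closed simplex may be glued to itself, but each preimage of `x` is the interior position of
`x` pushed along one of finitely many face embeddings. -/
theorem finite_charMap_fiber {n : ℕ} (r : B.cell n) (x : B.Realization) :
    (charMap r ⁻¹' {x}).Finite := by
  obtain ⟨m, s, p, hp, rfl⟩ := exists_mem_openCell x
  refine (Set.finite_range fun θ : Fin (m + 1) ↪o Fin (n + 1) => stdSimplex.map θ p).subset ?_
  intro q hq
  obtain ⟨θ, -, h⟩ := exists_face_of_charMap_eq hp hq
  exact ⟨θ, h⟩

theorem continuous_charMap {n : ℕ} (s : B.cell n) : Continuous (charMap s) :=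
  continuous_quot_mk.comp (continuous_sigmaMk (σ := fun c : (Σ n, B.cell n) =>
    stdSimplex ℝ (Fin (c.1 + 1))) (i := ⟨n, s⟩))

/-- Two points are identified exactly when they come from the same interior point of a common face,
so the relation is a finite union of compact images of simplices. -/
theorem isClosed_quot_rel [Finite (Σ n, B.cell n)] :
    IsClosed {z : B.PreRealization × B.PreRealization | Quot.mk Glue z.1 = Quot.mk Glue z.2} := by
  have : {z : B.PreRealization × B.PreRealization | Quot.mk Glue z.1 = Quot.mk Glue z.2} =
      ⋃ (c : Σ n, B.cell n) (a : Σ n, B.cell n) (b : Σ n, B.cell n)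
        (θ : Fin (c.1 + 1) ↪o Fin (a.1 + 1)) (η : Fin (c.1 + 1) ↪o Fin (b.1 + 1))
        (_ : pull θ a.2 = c.2 ∧ pull η b.2 = c.2),
        Set.range fun q : stdSimplex ℝ (Fin (c.1 + 1)) =>
          ((⟨a, stdSimplex.map θ q⟩, ⟨b, stdSimplex.map η q⟩) :
            B.PreRealization × B.PreRealization) := by
    ext ⟨⟨a, p⟩, ⟨b, q⟩⟩
    simp only [Set.mem_ofPred_eq, Set.mem_iUnion]
    constructor
    · intro h
      obtain ⟨⟨c, r⟩, hy, θ, h1, h2⟩ := exists_interior_onFace ⟨a, p⟩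
      obtain ⟨η, h3, h4⟩ := (onFace_of_eq hy h).1 ⟨θ, h1, h2⟩
      dsimp only at θ h1 h2 η h3 h4
      exact ⟨c, a, b, θ, η, ⟨h1, h3⟩, r, by dsimp only; rw [h2, h4]⟩
    · rintro ⟨c, a, b, θ, η, ⟨h1, h2⟩, r, h⟩
      simp only [Prod.mk.injEq] at h
      rw [← h.1, ← h.2]
      exact (quot_eq_of_onFace (y := ⟨c, r⟩) ⟨θ, h1, rfl⟩).trans
        (quot_eq_of_onFace (y := ⟨c, r⟩) ⟨η, h2, rfl⟩).symm
  rw [this]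
  refine isClosed_iUnion_of_finite fun c => isClosed_iUnion_of_finite fun a =>
    isClosed_iUnion_of_finite fun b => isClosed_iUnion_of_finite fun θ =>
    isClosed_iUnion_of_finite fun η => isClosed_iUnion_of_finite fun _ =>
    (isCompact_range ?_).isClosed
  exact (continuous_sigmaMk.comp (stdSimplex.continuous_map _)).prodMk
    (continuous_sigmaMk.comp (stdSimplex.continuous_map _))

/-- A quotient of a compact Hausdorff space by a closed relation is a Hausdorff space. -/
theorem t2Space_of_isClosed_rel {P Q : Type*} [TopologicalSpace P] [TopologicalSpace Q]
    [CompactSpace P] [T2Space P] {π : P → Q} (hπ : Topology.IsQuotientMap π)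
    (hR : IsClosed {z : P × P | π z.1 = π z.2}) : T2Space Q := by
  -- The saturation of a closed set is a projection along a compact factor.
  have hcl : IsClosedMap π := by
    intro K hK
    rw [← hπ.isClosed_preimage]
    have : π ⁻¹' (π '' K) = Prod.snd '' ({z : P × P | π z.1 = π z.2} ∩ Prod.fst ⁻¹' K) := by
      ext b
      simp only [Set.mem_preimage, Set.mem_image, Set.mem_inter_iff, Set.mem_ofPred_eq,
        Prod.exists, exists_eq_right]
      exact exists_congr fun a => and_comm
    rw [this]
    exact isClosedMap_snd_of_compactSpace _ (hR.inter (hK.preimage continuous_fst))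
  have hfib : ∀ x, IsClosed (π ⁻¹' {x}) := by
    intro x
    obtain ⟨a, rfl⟩ := hπ.surjective x
    have : π ⁻¹' {π a} = (fun b => (b, a)) ⁻¹' {z : P × P | π z.1 = π z.2} := by
      ext b; simp
    rw [this]
    exact hR.preimage (by fun_prop)
  refine ⟨fun x y hxy => ?_⟩
  obtain ⟨U, V, hU, hV, hxU, hyV, hUV⟩ := normal_separation
    (hfib x) (hfib y) (Disjoint.preimage π (by simpa using hxy))
  -- These are the points whose whole fibre lies in `U`, respectively in `V`.
  refine ⟨(π '' Uᶜ)ᶜ, (π '' Vᶜ)ᶜ, (hcl _ hU.isClosed_compl).isOpen_compl,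
    (hcl _ hV.isClosed_compl).isOpen_compl, ?_, ?_, ?_⟩
  · rintro ⟨a, ha, rfl⟩; exact ha (hxU rfl)
  · rintro ⟨a, ha, rfl⟩; exact ha (hyV rfl)
  · rw [Set.disjoint_left]
    intro z hz hz'
    obtain ⟨a, rfl⟩ := hπ.surjective z
    have h1 : a ∈ U := by by_contra h; exact hz ⟨a, h, rfl⟩
    have h2 : a ∈ V := by by_contra h; exact hz' ⟨a, h, rfl⟩
    exact Set.disjoint_left.1 hUV h1 h2

/-- Makes conditions of the form `f y = charMap s q` closed, on which the limit arguments below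
rest. -/
instance t2Space_realization [Finite (Σ n, B.cell n)] : T2Space B.Realization :=
  t2Space_of_isClosed_rel (π := fun z : B.PreRealization => (Quot.mk Glue z : B.Realization))
    isQuotientMap_quot_mk isClosed_quot_rel

theorem barycenter_mem_openSimplex (n : ℕ) :
    (stdSimplex.barycenter : stdSimplex ℝ (Fin (n + 1))) ∈ openSimplex n := by
  intro i
  have h := stdSimplex.barycenter_apply (𝕜 := ℝ) i
  rw [show (stdSimplex.barycenter : stdSimplex ℝ (Fin (n + 1))) i = _ from h]
  positivity

end SemiSimplicialSet

/-! ### Segments, edges and triangles in a simplex -/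

namespace SemiSimplicialSet

/-- The affine segment between two points of a standard simplex. -/
def simplexSegment {n : ℕ} (p q : stdSimplex ℝ (Fin (n + 1))) (t : unitInterval) :
    stdSimplex ℝ (Fin (n + 1)) :=
  ⟨fun i => (1 - (t : ℝ)) * p i + t * q i, by
    refine ⟨fun i => ?_, ?_⟩
    · have h1 := stdSimplex.zero_le p i
      have h2 := stdSimplex.zero_le q i
      have h3 := t.2.1
      have h4 := sub_nonneg.2 t.2.2
      positivity
    · rw [Finset.sum_add_distrib, ← Finset.mul_sum, ← Finset.mul_sum, stdSimplex.sum_eq_one,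
        stdSimplex.sum_eq_one]
      ring⟩

theorem simplexSegment_apply {n : ℕ} (p q : stdSimplex ℝ (Fin (n + 1))) (t : unitInterval)
    (i : Fin (n + 1)) : simplexSegment p q t i = (1 - (t : ℝ)) * p i + t * q i := rfl

theorem simplexSegment_zero {n : ℕ} (p q : stdSimplex ℝ (Fin (n + 1))) :
    simplexSegment p q 0 = p := by
  apply stdSimplex.ext
  funext i
  simp [simplexSegment_apply]

theorem simplexSegment_one {n : ℕ} (p q : stdSimplex ℝ (Fin (n + 1))) :
    simplexSegment p q 1 = q := by
  apply stdSimplex.ext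
  funext i
  simp [simplexSegment_apply]

theorem continuous_simplexSegment {n : ℕ} (p q : stdSimplex ℝ (Fin (n + 1))) :
    Continuous (simplexSegment p q) := by
  refine Continuous.subtype_mk (continuous_pi fun i => ?_) _
  fun_prop

theorem simplexSegment_mem_openSimplex {n : ℕ} {p q : stdSimplex ℝ (Fin (n + 1))}
    (hq : q ∈ openSimplex n) {t : unitInterval} (ht : 0 < (t : ℝ)) :
    simplexSegment p q t ∈ openSimplex n := by
  intro i
  rw [simplexSegment_apply]
  have h1 := stdSimplex.zero_le p i
  have h2 := hq i
  have h4 := sub_nonneg.2 t.2.2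
  positivity

theorem dense_openSimplex (n : ℕ) : Dense (openSimplex n) := by
  intro q
  have hmem : ∀ k : ℕ, (1 / ((k : ℝ) + 1)) ∈ unitInterval := fun k =>
    ⟨by positivity, by rw [div_le_one (by positivity)]; simp⟩
  have ht : Filter.Tendsto (fun k : ℕ => (⟨1 / ((k : ℝ) + 1), hmem k⟩ : unitInterval))
      Filter.atTop (nhds 0) :=
    tendsto_subtype_rng.2 tendsto_one_div_add_atTop_nhds_zero_nat
  have := ((continuous_simplexSegment q stdSimplex.barycenter).tendsto 0).comp ht
  rw [simplexSegment_zero] at this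
  refine mem_closure_of_tendsto this (Filter.Eventually.of_forall fun k => ?_)
  exact simplexSegment_mem_openSimplex (barycenter_mem_openSimplex n) (by positivity)

theorem simplexSegment_mem_openSimplex' {n : ℕ} {p q : stdSimplex ℝ (Fin (n + 1))}
    (hp : p ∈ openSimplex n) (hq : q ∈ openSimplex n) (t : unitInterval) :
    simplexSegment p q t ∈ openSimplex n := by
  rcases eq_or_lt_of_le t.2.1 with h | h
  · rw [show t = 0 from Subtype.ext h.symm, simplexSegment_zero]
    exact hp
  · exact simplexSegment_mem_openSimplex hq h

/-- The injection `[1] → [n]` with image `{i, j}`, `i < j`. -/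
def pairEmb {n : ℕ} (i j : Fin (n + 1)) (h : i < j) : Fin (1 + 1) ↪o Fin (n + 1) :=
  OrderEmbedding.ofStrictMono ![i, j] (by
    intro a b hab
    fin_cases a <;> fin_cases b <;> simp_all)

/-- The injection `[2] → [n]` with image `{i, j, k}`, `i < j < k`. -/
def tripleEmb {n : ℕ} (i j k : Fin (n + 1)) (h : i < j) (h' : j < k) :
    Fin (2 + 1) ↪o Fin (n + 1) :=
  OrderEmbedding.ofStrictMono ![i, j, k] (by
    have := h.trans h'
    intro a b hab
    fin_cases a <;> fin_cases b <;> simp_all)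

end SemiSimplicialSet

/-! ### Affine charts of cells, rigidity and tilings -/

namespace FBSComplex

open SemiSimplicialSet

variable {E : Type v} [NormedAddCommGroup E] [InnerProductSpace ℝ E] [FiniteDimensional ℝ E]
  {X : FBSComplex.{u, v} E}

instance finite_cell' (n : ℕ) : Finite (X.B.cell n) := X.finite_cell n

instance finite_sigma_cell : Finite (Σ n, X.B.cell n) := by
  refine Finite.of_surjective
    (fun z : (Σ n : Fin (Module.finrank ℝ E + 1), X.B.cell n) => ⟨z.1, z.2⟩) ?_
  rintro ⟨n, s⟩
  have hn : ¬ Module.finrank ℝ E < n := fun h => (X.isEmpty_above n h).false s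
  exact ⟨⟨⟨n, by omega⟩, s⟩, rfl⟩

/-- `ρ` kills the boundary of the triangle `i < j < k`; this additivity makes vertex positions
independent of the chosen edge path. -/
theorem rho_pairEmb {n : ℕ} (r : X.B.cell n) (i j k : Fin (n + 1)) (h : i < j) (h' : j < k) :
    X.ρ (Finsupp.single (pull (pairEmb i k (h.trans h')) r) 1) =
      X.ρ (Finsupp.single (pull (pairEmb i j h) r) 1) +
        X.ρ (Finsupp.single (pull (pairEmb j k h') r) 1) := by
  have h0 := X.ρ_boundary (Finsupp.single (pull (tripleEmb i j k h h') r) 1)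
  have e0 : face 0 (pull (tripleEmb i j k h h') r) = pull (pairEmb j k h') r := by
    rw [face, ← pull_trans]
    congr 1
  have e1 : face 1 (pull (tripleEmb i j k h h') r) = pull (pairEmb i k (h.trans h')) r := by
    rw [face, ← pull_trans]
    congr 1
    ext a
    fin_cases a <;> rfl
  have e2 : face 2 (pull (tripleEmb i j k h h') r) = pull (pairEmb i j h) r := by
    rw [face, ← pull_trans]
    congr 1
    ext a
    fin_cases a <;> rfl
  rw [boundary, show (∑ i : Fin (1 + 2), ((-1 : ℤ) ^ (i : ℕ)) •
    Finsupp.mapDomain.addMonoidHom (face (B := X.B) i)) = _ from Fin.sum_univ_three _] at h0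
  simp only [AddMonoidHom.add_apply, AddMonoidHom.smul_apply,
    Finsupp.mapDomain.addMonoidHom_apply, Finsupp.mapDomain_single, map_add, map_zsmul,
    e0, e1, e2] at h0
  simp only [Fin.val_zero, pow_zero, one_smul, Fin.val_one, pow_one, neg_smul,
    Fin.val_two, even_two, Even.neg_pow, one_pow] at h0
  rw [← sub_eq_zero, ← neg_eq_zero, ← h0]
  abel

/-- The position of a vertex of `s` relative to its vertex `0`. -/
def vertexVec {n : ℕ} (s : X.B.cell n) (i : Fin (n + 1)) : E :=
  if h : 0 < i then X.ρ (Finsupp.single (pull (pairEmb 0 i h) s) 1) else 0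

theorem vertexVec_zero {n : ℕ} (s : X.B.cell n) : vertexVec s 0 = 0 := by
  simp [vertexVec]

theorem vertexVec_succ {n : ℕ} (s : X.B.cell n) (j : Fin n) :
    vertexVec s j.succ = edgeVec s j := by
  rw [vertexVec, dif_pos (Fin.succ_pos j)]
  rfl

theorem vertexVec_pull {m n : ℕ} (θ : Fin (m + 1) ↪o Fin (n + 1)) (r : X.B.cell n)
    (i : Fin (m + 1)) : vertexVec (pull θ r) i = vertexVec r (θ i) - vertexVec r (θ 0) := by
  by_cases hi : 0 < i
  · have hθ : θ 0 < θ i := θ.strictMono hi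
    have e : pull (pairEmb 0 i hi) (pull θ r) = pull (pairEmb (θ 0) (θ i) hθ) r := by
      rw [← pull_trans]
      congr 1
      ext a
      fin_cases a <;> rfl
    rw [vertexVec, dif_pos hi, e, eq_sub_iff_add_eq]
    have hi' : 0 < θ i := (Fin.zero_le _).trans_lt hθ
    by_cases h0 : 0 < θ 0
    · rw [vertexVec, dif_pos h0, vertexVec, dif_pos hi', rho_pairEmb r 0 (θ 0) (θ i) h0 hθ, add_comm]
    · have h0' : θ 0 = 0 := le_antisymm (not_lt.1 h0) (Fin.zero_le _)
      have e0 : pairEmb (θ 0) (θ i) hθ = pairEmb 0 (θ i) hi' := by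
        congr 1
      rw [e0, h0', vertexVec_zero, vertexVec, dif_pos hi', add_zero]
  · have h0 : i = 0 := le_antisymm (not_lt.1 hi) (Fin.zero_le _)
    rw [h0, vertexVec_zero, sub_self]

/-- The extension of `α_s` to the closed simplex, in barycentric coordinates. -/
def affPos {n : ℕ} (s : X.B.cell n) (p : stdSimplex ℝ (Fin (n + 1))) : E :=
  ∑ i, p i • vertexVec s i

theorem affPos_eq {n : ℕ} (s : X.B.cell n) (p : stdSimplex ℝ (Fin (n + 1))) :
    affPos s p = ∑ j : Fin n, p j.succ • edgeVec s j := by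
  simp only [affPos, Fin.sum_univ_succ, vertexVec_zero, smul_zero, zero_add, vertexVec_succ]

theorem alpha_charMap_eq {n : ℕ} (s : X.B.cell n) {p : stdSimplex ℝ (Fin (n + 1))}
    (hp : p ∈ openSimplex n) : alpha s (charMap s p) = affPos s p := by
  rw [alpha_charMap s hp, affPos_eq]

theorem continuous_affPos {n : ℕ} (s : X.B.cell n) : Continuous (affPos s) := by
  refine continuous_finsetSum _ fun i _ => Continuous.smul ?_ continuous_const
  exact (continuous_apply i).comp continuous_subtype_val

/-- Passing to a face only changes the base vertex, and since barycentric coordinates sum to one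
this adds a constant. Hence differences of `affPos` are the same in a simplex and in its faces. -/
theorem affPos_map {m n : ℕ} (θ : Fin (m + 1) ↪o Fin (n + 1)) (r : X.B.cell n)
    (p : stdSimplex ℝ (Fin (m + 1))) :
    affPos r (stdSimplex.map θ p) = affPos (pull θ r) p + vertexVec r (θ 0) := by
  have h1 : affPos r (stdSimplex.map θ p) = ∑ i, p i • vertexVec r (θ i) := by
    rw [affPos, ← Finset.sum_subset (Finset.subset_univ (Finset.univ.map θ.toEmbedding)),
      Finset.sum_map]
    · exact Finset.sum_congr rfl fun i _ => congrArg (· • _) (map_apply_emb θ p i)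
    · intro j _ hj
      rw [map_apply_ne θ p j (by simpa using hj), zero_smul]
  rw [h1, affPos]
  simp only [vertexVec_pull, smul_sub, Finset.sum_sub_distrib]
  rw [← Finset.sum_smul, stdSimplex.sum_eq_one, one_smul, sub_add_cancel]

/-- An isometric winding is the inverse of a translate of `α_s` over each open cell. -/
theorem IsIsometricWinding.apply_add_affPos {f : C(E, X.Space)} (hf : IsIsometricWinding f) {n : ℕ}
    (s : X.B.cell n) {p q : stdSimplex ℝ (Fin (n + 1))} (hp : p ∈ openSimplex n)
    (hq : q ∈ openSimplex n) {y : E} (hy : f y = charMap s p) :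
    f (y + (affPos s q - affPos s p)) = charMap s q := by
  have hyF : y ∈ f ⁻¹' openCell s := ⟨p, hp, hy.symm⟩
  -- The segment from `p` to `q` stays in the open cell, so it lifts from `y`.
  let γ : C(unitInterval, openCell s) :=
    ⟨fun t => ⟨charMap s (simplexSegment p q t), _, simplexSegment_mem_openSimplex' hp hq t, rfl⟩,
      ((continuous_charMap s).comp (continuous_simplexSegment p q)).subtype_mk _⟩
  have hγ0 : γ 0 = (openCell s).restrictPreimage f ⟨y, hyF⟩ :=
    Subtype.ext (by
      change charMap s (simplexSegment p q 0) = f y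
      rw [simplexSegment_zero, hy])
  obtain ⟨Γ, hΓ, hΓ0⟩ := (hf.isCoveringMap n s).exists_path_lifts γ ⟨y, hyF⟩ hγ0
  have hΓt : ∀ t, f (Γ t) = charMap s (simplexSegment p q t) := fun t =>
    congrArg Subtype.val (congrFun hΓ t)
  have h1 : f (Γ 1) = charMap s q := by rw [hΓt, simplexSegment_one]
  obtain ⟨v, hv⟩ := hf.translation n s y hyF
  -- The lift stays in one component, where a single translation vector `v` serves both endpoints;
  -- this locates the endpoint of the lift.
  have hsub : Set.range (fun t => (Γ t : E)) ⊆ connectedComponentIn (f ⁻¹' openCell s) y := by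
    refine (isPreconnected_range
      (continuous_subtype_val.comp Γ.continuous)).subset_connectedComponentIn
      ⟨0, by simp [hΓ0]⟩ ?_
    rintro _ ⟨t, rfl⟩
    exact (Γ t).2
  have h2 := hv (Γ 1) (hsub ⟨1, rfl⟩)
  have h3 := hv y (mem_connectedComponentIn hyF)
  rw [h1, alpha_charMap_eq s hq] at h2
  rw [hy, alpha_charMap_eq s hp] at h3
  rw [h2, h3, add_sub_add_right_eq_sub, add_sub_cancel, h1]

/-- Every point lies in a translate of a closed top-dimensional simplex on which `f` is the
characteristic map. -/
def IsTiled (f : C(E, X.Space)) : Prop :=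
  ∀ y : E, ∃ (s : X.B.cell (Module.finrank ℝ E))
    (p : stdSimplex ℝ (Fin (Module.finrank ℝ E + 1))),
    ∀ q, f (y + (affPos s q - affPos s p)) = charMap s q

/-- The quantifier over `p` is a projection along a compact simplex, and `s` ranges over a finite
set. Joint closedness in map and point serves both limits in `E` and limits in the hull. -/
theorem isClosed_tiled : IsClosed {z : C(E, X.Space) × E |
    ∃ (s : X.B.cell (Module.finrank ℝ E)) (p : stdSimplex ℝ (Fin (Module.finrank ℝ E + 1))),
      ∀ q, z.1 (z.2 + (affPos s q - affPos s p)) = charMap s q} := by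
  have : {z : C(E, X.Space) × E |
      ∃ (s : X.B.cell (Module.finrank ℝ E)) (p : stdSimplex ℝ (Fin (Module.finrank ℝ E + 1))),
      ∀ q, z.1 (z.2 + (affPos s q - affPos s p)) = charMap s q} =
      ⋃ s : X.B.cell (Module.finrank ℝ E), Prod.fst ''
        {w : (C(E, X.Space) × E) × stdSimplex ℝ (Fin (Module.finrank ℝ E + 1)) |
          ∀ q, w.1.1 (w.1.2 + (affPos s q - affPos s w.2)) = charMap s q} := by
    ext z
    simp
  rw [this]
  refine isClosed_iUnion_of_finite fun s => isClosedMap_fst_of_compactSpace _ ?_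
  simp only [Set.ofPred_forall]
  refine isClosed_iInter fun q => isClosed_eq ?_ continuous_const
  have := continuous_affPos s
  fun_prop

theorem IsTiled.of_mem_hull {f₀ f : C(E, X.Space)} (h : IsTiled f₀) (hf : f ∈ hull f₀) :
    IsTiled f := by
  intro y
  have hcl : IsClosed {g : C(E, X.Space) | ∃ (s : X.B.cell (Module.finrank ℝ E))
      (p : stdSimplex ℝ (Fin (Module.finrank ℝ E + 1))),
      ∀ q, g (y + (affPos s q - affPos s p)) = charMap s q} :=
    isClosed_tiled.preimage (f := fun g : C(E, X.Space) => (g, y)) (by fun_prop)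
  refine closure_minimal ?_ hcl hf
  rintro _ ⟨t, rfl⟩
  obtain ⟨s, p, hp⟩ := h (y - t)
  refine ⟨s, p, fun q => ?_⟩
  rw [← hp q]
  simp only [translate, ContinuousMap.comp_apply, ContinuousMap.coe_mk]
  congr 1
  abel

/-- The open cell containing `f y` is a face of the tile around `y`, and differences of `affPos` may
be computed in that tile. Here `q` may lie on the boundary. -/
theorem IsTiled.apply_add_affPos {f : C(E, X.Space)} (hf : IsTiled f) {n : ℕ} (s : X.B.cell n)
    {p : stdSimplex ℝ (Fin (n + 1))} (hp : p ∈ openSimplex n) (q : stdSimplex ℝ (Fin (n + 1)))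
    {y : E} (hy : f y = charMap s p) : f (y + (affPos s q - affPos s p)) = charMap s q := by
  obtain ⟨r, p', hp'⟩ := hf y
  have h1 := hp' p'
  rw [sub_self, add_zero, hy] at h1
  obtain ⟨θ, rfl, rfl⟩ := exists_face_of_charMap_eq hp h1.symm
  have h2 := hp' (stdSimplex.map θ q)
  rwa [affPos_map, affPos_map, add_sub_add_right_eq_sub, charMap_map] at h2

/-- Fibres of a covering are discrete, and discrete subspaces of `E` are countable. -/
theorem IsIsometricWinding.countable_fiber {f : C(E, X.Space)} (hf : IsIsometricWinding f) {n : ℕ}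
    {s : X.B.cell n} {x : X.Space} (hx : x ∈ openCell s) : (f ⁻¹' {x}).Countable := by
  have hd := (hf.isCoveringMap n s ⟨x, hx⟩).discreteTopology_fiber
  have hc : Countable ((openCell s).restrictPreimage f ⁻¹' {⟨x, hx⟩}) :=
    countable_of_Lindelof_of_discrete
  refine (Set.countable_range fun z : (openCell s).restrictPreimage f ⁻¹' {⟨x, hx⟩} =>
    ((z : f ⁻¹' openCell s) : E)).mono fun y hy => ?_
  have hy' : f y = x := hy
  exact ⟨⟨⟨y, by rw [Set.mem_preimage, hy']; exact hx⟩, Subtype.ext hy'⟩, rfl⟩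

section Measure

variable [MeasurableSpace E] [BorelSpace E]

/-- By rigidity each point over `|s|` differs from a point over the barycenter by a vector in the
span of fewer than `d` edges. There are countably many such points. -/
theorem IsIsometricWinding.volume_preimage_openCell {f : C(E, X.Space)}
    (hf : IsIsometricWinding f) {n : ℕ} (hn : n < Module.finrank ℝ E) (s : X.B.cell n) :
    volume (f ⁻¹' openCell s) = 0 := by
  let b : stdSimplex ℝ (Fin (n + 1)) := stdSimplex.barycenter
  have hb : b ∈ openSimplex n := barycenter_mem_openSimplex n
  let V : Submodule ℝ E := Submodule.span ℝ (Set.range (edgeVec s))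
  have hV : V ≠ ⊤ := by
    intro h
    have h1 : Module.finrank ℝ V ≤ n := (finrank_range_le_card (edgeVec s)).trans (by simp)
    rw [h, finrank_top] at h1
    omega
  have hVmem : ∀ p, affPos s p ∈ V := fun p => by
    rw [affPos_eq]
    exact V.sum_mem fun j _ => V.smul_mem _ (Submodule.subset_span ⟨j, rfl⟩)
  have hcov : f ⁻¹' openCell s ⊆ ⋃ z ∈ f ⁻¹' {charMap s b}, (fun y => y + z) '' (V : Set E) := by
    rintro y ⟨p, hp, hy⟩
    have := hf.apply_add_affPos s hp hb hy.symm
    refine Set.mem_biUnion (x := y + (affPos s b - affPos s p)) this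
      ⟨affPos s p - affPos s b, V.sub_mem (hVmem _) (hVmem _), ?_⟩
    dsimp only
    abel
  refine measure_mono_null hcov ((measure_biUnion_null_iff
    (hf.countable_fiber ⟨b, hb, rfl⟩)).2 fun z _ => ?_)
  rw [Set.image_add_right, measure_preimage_add_right]
  exact Measure.addHaar_submodule _ V hV

theorem IsIsometricWinding.isTiled {f : C(E, X.Space)} (hf : IsIsometricWinding f) :
    IsTiled f := by
  have hae : ∀ᵐ y : E, ∃ s : X.B.cell (Module.finrank ℝ E), f y ∈ openCell s := by
    have h : ∀ᵐ y : E, ∀ (n : Fin (Module.finrank ℝ E)) (s : X.B.cell n), f y ∉ openCell s := by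
      refine ae_all_iff.2 fun n => ae_all_iff.2 fun s => ?_
      have := hf.volume_preimage_openCell n.2 s
      exact measure_eq_zero_iff_ae_notMem.1 this
    filter_upwards [h] with y hy
    obtain ⟨n, s, hs⟩ := exists_mem_openCell (f y)
    rcases lt_trichotomy n (Module.finrank ℝ E) with h1 | h1 | h1
    · exact absurd hs (hy ⟨n, h1⟩ s)
    · subst h1
      exact ⟨s, hs⟩
    · exact ((X.isEmpty_above n h1).false s).elim
  have hcl : IsClosed {y : E | ∃ (s : X.B.cell (Module.finrank ℝ E))
      (p : stdSimplex ℝ (Fin (Module.finrank ℝ E + 1))),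
      ∀ q, f (y + (affPos s q - affPos s p)) = charMap s q} :=
    isClosed_tiled.preimage (f := fun y : E => (f, y)) (by fun_prop)
  intro y
  refine closure_minimal ?_ hcl (Measure.dense_of_ae hae y)
  rintro z ⟨s, p, hp, hz⟩
  refine ⟨s, p, fun q => ?_⟩
  have hc : IsClosed {q | f (z + (affPos s q - affPos s p)) = charMap s q} := by
    refine isClosed_eq ?_ (continuous_charMap s)
    have := continuous_affPos s
    fun_prop
  -- Rigidity gives the identity on the open simplex; density extends it to the closed one.
  refine closure_minimal (fun q hq => ?_) hc (dense_openSimplex _ q)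
  exact hf.apply_add_affPos s hp hq hz.symm

end Measure

end FBSComplex

/-! ### Uniform weighted bounds and semicontinuity of sums over fibres -/

namespace FBSComplex

open SemiSimplicialSet

section Weight

variable {E : Type v} [NormedAddCommGroup E] [InnerProductSpace ℝ E]

/-- A summable weight on `E`. -/
def weight (y : E) : ℝ := ((1 + ‖y‖) ^ (Module.finrank ℝ E + 1))⁻¹

theorem weight_pos (y : E) : 0 < weight y := by
  unfold weight
  positivity

theorem weight_le {y z : E} {R : ℝ} (hR : 0 ≤ R) (h : ‖z - y‖ ≤ R) :
    weight y ≤ (1 + R) ^ (Module.finrank ℝ E + 1) * weight z := by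
  unfold weight
  have h1 : 1 + ‖z‖ ≤ (1 + R) * (1 + ‖y‖) := by
    have := norm_le_norm_add_norm_sub' z y
    nlinarith [norm_nonneg y, mul_nonneg hR (norm_nonneg y)]
  have h2 := pow_le_pow_left₀ (by positivity) h1 (Module.finrank ℝ E + 1)
  rw [mul_pow] at h2
  rw [← div_eq_mul_inv, le_div_iff₀ (by positivity), inv_mul_le_iff₀ (by positivity)]
  linarith

end Weight

variable {E : Type v} [NormedAddCommGroup E] [InnerProductSpace ℝ E] [FiniteDimensional ℝ E]
  {X : FBSComplex.{u, v} E}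

/-- In the basis of edge vectors the open simplex is cut out by strict inequalities: positive
coordinates with sum below one. -/
theorem exists_ball_subset_affPos (s : X.B.cell (Module.finrank ℝ E)) :
    ∃ (c : E) (r : ℝ), 0 < r ∧ Metric.ball c r ⊆ affPos s '' openSimplex (Module.finrank ℝ E) := by
  have hli : LinearIndependent ℝ (edgeVec s) := X.linearIndependent s
  let b : Module.Basis (Fin (Module.finrank ℝ E)) ℝ E :=
    Module.Basis.mk hli (hli.span_eq_top_of_card_eq_finrank' (by simp)).ge
  have hb : ∀ j, b j = edgeVec s j := fun j => by simp [b]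
  let O : Set E := {v | (∀ j, 0 < b.equivFunL v j) ∧ ∑ j, b.equivFunL v j < 1}
  have hO : IsOpen O := by
    refine IsOpen.and ?_ (isOpen_lt (by fun_prop) continuous_const)
    simp only [Set.ofPred_forall]
    exact isOpen_iInter_of_finite fun j => isOpen_lt continuous_const (by fun_prop)
  have hcoord : ∀ q j, b.equivFunL (affPos s q) j = q j.succ := by
    intro q j
    rw [affPos_eq]
    simp only [← hb, map_sum, map_smul, Finset.sum_apply, Pi.smul_apply]
    simp [Finsupp.single_apply]
  have hbary : affPos s stdSimplex.barycenter ∈ O := by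
    have hpos := barycenter_mem_openSimplex (Module.finrank ℝ E)
    refine ⟨fun j => ?_, ?_⟩
    · rw [hcoord]
      exact hpos _
    · simp only [hcoord]
      have h1 := stdSimplex.sum_eq_one
        (stdSimplex.barycenter : stdSimplex ℝ (Fin (Module.finrank ℝ E + 1)))
      rw [Fin.sum_univ_succ] at h1
      linarith [hpos 0]
  obtain ⟨r, hr, hsub⟩ := Metric.isOpen_iff.1 hO _ hbary
  refine ⟨affPos s stdSimplex.barycenter, r, hr, fun v hv => ?_⟩
  obtain ⟨h1, h2⟩ := hsub hv
  let q : stdSimplex ℝ (Fin (Module.finrank ℝ E + 1)) :=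
    ⟨Fin.cons (1 - ∑ j, b.equivFunL v j) (b.equivFunL v),
      fun i => Fin.cases (sub_nonneg.2 h2.le) (fun j => (h1 j).le) i, by
        rw [Fin.sum_univ_succ]; simp⟩
  refine ⟨q, fun i => Fin.cases (sub_pos.2 h2) h1 i, ?_⟩
  rw [affPos_eq]
  conv_rhs => rw [← b.sum_equivFun v]
  exact Finset.sum_congr rfl fun j _ => by rw [hb]; rfl

variable (X) in
theorem exists_ball_subset_affPos_uniform : ∃ r : ℝ, 0 < r ∧
    ∀ s : X.B.cell (Module.finrank ℝ E), ∃ c : E,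
      Metric.ball c r ⊆ affPos s '' openSimplex (Module.finrank ℝ E) := by
  choose c r hr hc using fun s : X.B.cell (Module.finrank ℝ E) => exists_ball_subset_affPos s
  have := X.nonempty_top
  obtain ⟨s₀, hs₀⟩ := Finite.exists_min r
  exact ⟨r s₀, hr s₀, fun s => ⟨c s, (Metric.ball_subset_ball (hs₀ s)).trans (hc s)⟩⟩

variable (X) in
theorem exists_norm_affPos_sub_le : ∃ R : ℝ, 0 ≤ R ∧
    ∀ (s : X.B.cell (Module.finrank ℝ E)) p q, ‖affPos s q - affPos s p‖ ≤ R := by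
  have h : ∀ s : X.B.cell (Module.finrank ℝ E), ∃ R : ℝ, ∀ p, ‖affPos s p‖ ≤ R := fun s => by
    obtain ⟨R, hR⟩ := (isCompact_range (continuous_affPos s)).isBounded.exists_norm_le
    exact ⟨R, fun p => hR _ ⟨p, rfl⟩⟩
  choose R hR using h
  have := X.nonempty_top
  obtain ⟨s₀, hs₀⟩ := Finite.exists_max R
  have hR' : ∀ s p, ‖affPos s p‖ ≤ R s₀ := fun s p => (hR s p).trans (hs₀ s)
  refine ⟨R s₀ + R s₀, ?_, fun s p q => (norm_sub_le _ _).trans (add_le_add (hR' _ _) (hR' _ _))⟩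
  have := (norm_nonneg _).trans (hR' s₀ stdSimplex.barycenter)
  linarith

theorem integrable_weight [MeasurableSpace E] [BorelSpace E] :
    Integrable (weight : E → ℝ) := by
  have := integrable_one_add_norm (E := E) (μ := volume) (r := (Module.finrank ℝ E + 1 : ℕ))
    (by push_cast; linarith)
  refine this.congr (Filter.Eventually.of_forall fun y => ?_)
  dsimp only [weight]
  rw [Real.rpow_neg (by positivity), Real.rpow_natCast]

/-- The point set `f⁻¹(x)` has a uniformly bounded weight. -/
theorem exists_sum_weight_le [MeasurableSpace E] [BorelSpace E] (x : X.Space) :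
    ∃ M : ℝ, 0 ≤ M ∧ ∀ f : C(E, X.Space), IsTiled f → ∀ F : Finset E, (∀ y ∈ F, f y = x) →
      ∑ y ∈ F, weight y ≤ M := by
  classical
  obtain ⟨r, hr, hball⟩ := exists_ball_subset_affPos_uniform X
  choose c hc using hball
  obtain ⟨R, hR0, hR⟩ := exists_norm_affPos_sub_le X
  obtain ⟨K, hK⟩ := (Set.finite_range fun s : X.B.cell (Module.finrank ℝ E) =>
    (finite_charMap_fiber s x).toFinset.card).bddAbove
  have hK' : ∀ s : X.B.cell (Module.finrank ℝ E),
      (finite_charMap_fiber s x).toFinset.card ≤ K := fun s => hK ⟨s, rfl⟩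
  let vol : ℝ := volume.real (Metric.ball (0 : E) r)
  have hvol : 0 < vol := by
    refine ENNReal.toReal_pos (Metric.measure_ball_pos _ _ hr).ne' measure_ball_lt_top.ne
  let C : ℝ := (1 + R) ^ (Module.finrank ℝ E + 1)
  have hw := integrable_weight (E := E)
  refine ⟨vol⁻¹ * (C * (K * ∫ z : E, weight z)), ?_, fun f hf F hF => ?_⟩
  · have : 0 ≤ ∫ z : E, weight z := integral_nonneg fun z => (weight_pos z).le
    positivity
  choose s p hp using hf
  have hpx : ∀ y ∈ F, charMap (s y) (p y) = x := fun y hy => by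
    have := hp y (p y)
    rw [sub_self, add_zero, hF y hy] at this
    exact this.symm
  -- A ball of the uniform radius `r` inside the interior of the tile chosen for `y`.
  let D : E → Set E := fun y => Metric.ball (y - affPos (s y) (p y) + c (s y)) r
  have hD : ∀ y, ∀ z ∈ D y, ∃ q ∈ openSimplex (Module.finrank ℝ E),
      z = y + (affPos (s y) q - affPos (s y) (p y)) := by
    intro y z hz
    obtain ⟨q, hq, hqz⟩ := hc (s y) (show z - (y - affPos (s y) (p y)) ∈ Metric.ball (c (s y)) r by
      rw [Metric.mem_ball, dist_eq_norm] at hz ⊢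
      convert hz using 2
      abel)
    refine ⟨q, hq, ?_⟩
    rw [hqz]
    abel
  -- If `z` lies in `D y` and in `D y₀`, then `f z` determines both the cell and the position of `z`
  -- in it. So `y` is determined by `p y`, one of at most `K` preimages of `x`.
  have hcount : ∀ z, ((F.filter fun y => z ∈ D y).card : ℝ) ≤ K := by
    intro z
    rcases (F.filter fun y => z ∈ D y).eq_empty_or_nonempty with h0 | ⟨y₀, hy₀⟩
    · rw [h0]; simp
    rw [Finset.mem_filter] at hy₀
    obtain ⟨q₀, hq₀, hz₀⟩ := hD y₀ z hy₀.2
    have hsub : (F.filter fun y => z ∈ D y) ⊆ (finite_charMap_fiber (s y₀) x).toFinset.image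
        fun p' => z - affPos (s y₀) q₀ + affPos (s y₀) p' := by
      intro y hy
      rw [Finset.mem_filter] at hy
      obtain ⟨q, hq, hz⟩ := hD y z hy.2
      have e1 := hp y q
      have e2 := hp y₀ q₀
      rw [← hz] at e1
      rw [← hz₀, e1] at e2
      have e3 := eq_of_interior (x := ⟨⟨_, s y⟩, q⟩) (y := ⟨⟨_, s y₀⟩, q₀⟩) hq hq₀ e2
      have e4 : s y = s y₀ := by simpa using congrArg Sigma.fst e3
      rw [Finset.mem_image]
      refine ⟨p y, ?_, ?_⟩
      · rw [Set.Finite.mem_toFinset, ← e4]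
        exact hpx y hy.1
      · have e5 : q = q₀ := by
          rw [e4] at e3
          simpa using e3
        rw [← e4, ← e5, hz]
        abel
    exact_mod_cast (Finset.card_le_card hsub).trans (Finset.card_image_le.trans (hK' _))
  -- The weight at `y` is compared with its average over `D y`, which is within distance `R` of `y`.
  have hterm : ∀ y, weight y * vol ≤ C * ∫ z, (D y).indicator weight z := by
    intro y
    rw [integral_indicator measurableSet_ball, ← integral_const_mul]
    have hv : volume.real (D y) = vol := by
      simp only [Measure.real, D, vol]
      rw [Measure.addHaar_ball_center]
    have hfin : volume (D y) ≠ ⊤ := measure_ball_lt_top.ne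
    have : ∫ _ in D y, weight y = weight y * vol := by
      rw [setIntegral_const, hv, smul_eq_mul, mul_comm]
    rw [← this]
    refine setIntegral_mono_on (integrableOn_const hfin) (hw.integrableOn.const_mul _)
      measurableSet_ball fun z hz => weight_le hR0 ?_
    obtain ⟨q, -, rfl⟩ := hD y z hz
    rw [add_sub_cancel_left]
    exact hR _ _ _
  rw [le_inv_mul_iff₀ hvol, mul_comm, Finset.sum_mul]
  refine (Finset.sum_le_sum fun y _ => hterm y).trans ?_
  rw [← Finset.mul_sum, ← integral_finsetSum _ fun y _ => hw.indicator measurableSet_ball,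
    ← integral_const_mul (K : ℝ)]
  refine mul_le_mul_of_nonneg_left (integral_mono
    (integrable_finsetSum _ fun y _ => hw.indicator measurableSet_ball)
    (hw.const_mul _) fun z => ?_) (by positivity)
  have : ∑ y ∈ F, (D y).indicator weight z = (F.filter fun y => z ∈ D y).card * weight z := by
    simp only [Set.indicator_apply]
    rw [← Finset.sum_filter, Finset.sum_const, nsmul_eq_mul]
  dsimp only
  rw [this]
  exact mul_le_mul_of_nonneg_right (hcount z) (weight_pos z).le

/-- The set of the maps that take the value `x` in a given open set is open in the hull. -/
theorem isOpen_hits {f₀ : C(E, X.Space)} (h₀ : IsTiled f₀) (x : X.Space) {V : Set E}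
    (hV : IsOpen V) : IsOpen {f : hull f₀ | ∃ y ∈ V, (f : C(E, X.Space)) y = x} := by
  rw [isOpen_iff_mem_nhds]
  rintro f ⟨y, hyV, hy⟩
  obtain ⟨ε, hε, hball⟩ := Metric.isOpen_iff.1 hV y hyV
  -- Positions in `s` with no point over `x` at distance below `ε`. Their images form a closed set
  -- avoiding `x`, so any `g` with `g y` outside it takes the value `x` near `y`.
  let K (s : X.B.cell (Module.finrank ℝ E)) :
      Set (stdSimplex ℝ (Fin (Module.finrank ℝ E + 1))) :=
    {p | ∀ q, charMap s q = x → ε ≤ ‖affPos s q - affPos s p‖}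
  have hK : ∀ s, IsClosed (K s) := by
    intro s
    simp only [K, Set.ofPred_forall]
    have := continuous_affPos s
    exact isClosed_iInter fun q => isClosed_iInter fun _ =>
      isClosed_le continuous_const (by fun_prop)
  let U : Set X.Space := ⋂ s, (charMap s '' K s)ᶜ
  have hU : IsOpen U := isOpen_iInter_of_finite fun s =>
    ((hK s).isCompact.image (continuous_charMap s)).isClosed.isOpen_compl
  have hxU : x ∈ U := by
    refine Set.mem_iInter.2 fun s => ?_
    rintro ⟨p, hp, hpx⟩
    have := hp p hpx
    rw [sub_self, norm_zero] at this
    linarith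
  have hcont : Continuous fun g : hull f₀ => (g : C(E, X.Space)) y :=
    (continuous_eval_const y).comp continuous_subtype_val
  have hmem : (fun g : hull f₀ => (g : C(E, X.Space)) y) ⁻¹' U ∈ nhds f :=
    (hU.preimage hcont).mem_nhds (by rw [Set.mem_preimage, hy]; exact hxU)
  filter_upwards [hmem] with g hg
  obtain ⟨s, p, hp⟩ := h₀.of_mem_hull g.2 y
  have hgy := hp p
  rw [sub_self, add_zero] at hgy
  have hpK : p ∉ K s := fun h => Set.mem_iInter.1 hg s ⟨p, h, hgy.symm⟩
  simp only [K, Set.mem_ofPred_eq, not_forall, not_le] at hpK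
  obtain ⟨q, hqx, hq⟩ := hpK
  refine ⟨y + (affPos s q - affPos s p), hball ?_, (hp q).trans hqx⟩
  rwa [Metric.mem_ball, dist_eq_norm, add_sub_cancel_left]

/-- Finitely many points of a fibre persist, slightly moved, for nearby maps, and further points can
only increase the sum. -/
theorem lowerSemicontinuous_tsum_fiber {f₀ : C(E, X.Space)} (h₀ : IsTiled f₀) (x : X.Space)
    {g : E → ENNReal} (hg : Continuous g) : LowerSemicontinuous fun f : hull f₀ =>
      ∑' y : (f : C(E, X.Space)) ⁻¹' {x}, g y := by
  intro f c hc
  dsimp only at hc ⊢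
  rw [gt_iff_lt, ENNReal.tsum_eq_iSup_sum, lt_iSup_iff] at hc
  obtain ⟨F, hF⟩ := hc
  -- Distinctness is kept so that the moved points still count separately.
  let O : Set (F → E) := {z | c < ∑ y, g (z y) ∧ ∀ y y', y ≠ y' → z y ≠ z y'}
  have hO : IsOpen O := by
    refine IsOpen.and (isOpen_lt continuous_const (by fun_prop)) ?_
    simp only [Set.ofPred_forall]
    exact isOpen_iInter_of_finite fun y => isOpen_iInter_of_finite fun y' =>
      isOpen_iInter_of_finite fun _ => isOpen_ne_fun (by fun_prop) (by fun_prop)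
  have hmem : (fun y : F => ((y : (f : C(E, X.Space)) ⁻¹' {x}) : E)) ∈ O := by
    refine ⟨?_, fun y y' hyy' h => hyy' (Subtype.ext (Subtype.ext h))⟩
    rwa [Finset.sum_coe_sort F fun y => g y]
  obtain ⟨ε, hε, hball⟩ := Metric.isOpen_iff.1 hO _ hmem
  have hev : ∀ᶠ f' : hull f₀ in nhds f, ∀ y : F, ∃ z ∈ Metric.ball (y : E) ε,
      (f' : C(E, X.Space)) z = x :=
    Filter.eventually_all.2 fun y => (isOpen_hits h₀ x Metric.isOpen_ball).mem_nhds
      ⟨y, Metric.mem_ball_self hε, y.1.2⟩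
  filter_upwards [hev] with f' hf'
  choose z hz hzx using hf'
  have hzO : z ∈ O := hball (by
    rw [Metric.mem_ball, dist_pi_lt_iff hε]
    exact hz)
  refine hzO.1.trans_le ?_
  have hinj : Function.Injective fun y : F => (⟨z y, hzx y⟩ : (f' : C(E, X.Space)) ⁻¹' {x}) := by
    intro y y' h
    by_contra hne
    exact hzO.2 y y' hne (congrArg Subtype.val h)
  rw [← tsum_fintype (L := .unconditional _)]
  exact ENNReal.tsum_comp_le_tsum_of_injective hinj
    fun y : (f' : C(E, X.Space)) ⁻¹' {x} => g y

end FBSComplex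

/-! ### Fibre sums as functions on the hull -/

namespace FBSComplex

open SemiSimplicialSet

section Weight

variable {E : Type v} [NormedAddCommGroup E] [InnerProductSpace ℝ E]

theorem weight_neg (y : E) : weight (-y) = weight y := by
  simp [weight]

theorem weight_le_one (y : E) : weight y ≤ 1 :=
  inv_le_one_of_one_le₀ (one_le_pow₀ (by linarith [norm_nonneg y]))

/-- Two factors of the weight are needed for convolutions: one is summed over the fibre, the other
integrated over `E`. -/
theorem exists_norm_le_weight_sq (φ : 𝓢(E, ℂ)) :
    ∃ C : ℝ, 0 ≤ C ∧ ∀ y, ‖φ y‖ ≤ C * (weight y * weight y) := by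
  let N := (Module.finrank ℝ E + 1) + (Module.finrank ℝ E + 1)
  obtain ⟨C, h⟩ : ∃ C : ℝ, ∀ y, (1 + ‖y‖) ^ N * ‖φ y‖ ≤ C := by
    have h := SchwartzMap.one_add_le_sup_seminorm_apply (𝕜 := ℂ) (m := (N, 0)) le_rfl le_rfl φ
    simp only [norm_iteratedFDeriv_zero] at h
    exact ⟨_, h⟩
  have hC : 0 ≤ C := le_trans (by positivity) (h 0)
  refine ⟨C, hC, fun y => ?_⟩
  have h2 : weight y * weight y = ((1 + ‖y‖) ^ N)⁻¹ := by
    rw [weight, ← mul_inv, ← pow_add]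
  rw [h2, ← div_eq_mul_inv, le_div_iff₀ (by positivity), mul_comm]
  exact h y

theorem exists_norm_le_weight (φ : 𝓢(E, ℂ)) :
    ∃ C : ℝ, 0 ≤ C ∧ ∀ y, ‖φ y‖ ≤ C * weight y := by
  obtain ⟨C, hC, h⟩ := exists_norm_le_weight_sq φ
  refine ⟨C, hC, fun y => (h y).trans (mul_le_mul_of_nonneg_left ?_ hC)⟩
  exact mul_le_of_le_one_left (weight_pos y).le (weight_le_one y)

end Weight

variable {E : Type v} [NormedAddCommGroup E] [InnerProductSpace ℝ E] [FiniteDimensional ℝ E]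
  {X : FBSComplex.{u, v} E}

theorem exists_tsum_weight_le [MeasurableSpace E] [BorelSpace E] (x : X.Space) :
    ∃ M : ℝ, 0 ≤ M ∧ ∀ f : C(E, X.Space), IsTiled f →
      (Summable fun y : f ⁻¹' {x} => weight (y : E)) ∧ ∑' y : f ⁻¹' {x}, weight (y : E) ≤ M := by
  obtain ⟨M, hM, h⟩ := exists_sum_weight_le x
  refine ⟨M, hM, fun f hf => ?_⟩
  have h0 : (0 : f ⁻¹' {x} → ℝ) ≤ fun y : f ⁻¹' {x} => weight (y : E) := fun y => (weight_pos _).le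
  have hF : ∀ F : Finset (f ⁻¹' {x}), ∑ y ∈ F, weight (y : E) ≤ M := fun F => by
    have := h f hf (F.map (Function.Embedding.subtype _)) (fun y hy => by
      obtain ⟨z, -, rfl⟩ := Finset.mem_map.1 hy
      exact z.2)
    simpa using this
  exact ⟨summable_of_sum_le h0 hF, Real.tsum_le_of_sum_le h0 hF⟩

/-- The sum of `g (-y)` over the points `y` of `f⁻¹(x)`. -/
def fiberSum (x : X.Space) (g : E → ℂ) (f : C(E, X.Space)) : ℂ := ∑' y : f ⁻¹' {x}, g (-(y : E))

theorem fiberSum_shift {x x' : X.Space} {f f' : C(E, X.Space)} (v : E)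
    (h : ∀ y, f y = x ↔ f' (y + v) = x') (g : E → ℂ) :
    fiberSum x' g f' = fiberSum x (fun y => g (y - v)) f := by
  rw [fiberSum, fiberSum, ← ((Equiv.addRight v).subtypeEquiv h).tsum_eq]
  refine tsum_congr fun y => ?_
  change g (-((y : E) + v)) = g (-(y : E) - v)
  rw [neg_add']

theorem fiberSum_translate (x : X.Space) (g : E → ℂ) (t : E) (f : C(E, X.Space)) :
    fiberSum x g (translate t f) = fiberSum x (fun y => g (y - t)) f :=
  fiberSum_shift t (fun y => by simp [translate]) g

/-- By rigidity in both directions, translation by the difference of `α_s` is a bijection between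
the two fibres. -/
theorem IsTiled.fiberSum_openCell {f : C(E, X.Space)} (hf : IsTiled f) {n : ℕ} (s : X.B.cell n)
    {x x' : X.Space} (hx : x ∈ openCell s) (hx' : x' ∈ openCell s) (g : E → ℂ) :
    fiberSum x' g f = fiberSum x g (translate (alpha s x' - alpha s x) f) := by
  rw [fiberSum_translate]
  refine fiberSum_shift _ (fun y => ?_) g
  obtain ⟨p, hp, rfl⟩ := hx
  obtain ⟨q, hq, rfl⟩ := hx'
  rw [alpha_charMap_eq s hp, alpha_charMap_eq s hq]
  refine ⟨fun h => hf.apply_add_affPos s hp q h, fun h => ?_⟩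
  have := hf.apply_add_affPos s hq p h
  rwa [show y + (affPos s q - affPos s p) + (affPos s p - affPos s q) = y by abel] at this

theorem Gamma_eq_fiberSum {f₀ : C(E, X.Space)} (x : X.Space) (φ : 𝓢(E, ℂ)) (f : hull f₀) :
    Gamma x φ f = fiberSum x φ (f : C(E, X.Space)) := rfl

section Bound

variable [MeasurableSpace E] [BorelSpace E]

theorem IsTiled.summable_fiber {f : C(E, X.Space)} (hf : IsTiled f) (x : X.Space) {g : E → ℂ}
    {C : ℝ} (hg : ∀ y, ‖g y‖ ≤ C * weight y) : Summable fun y : f ⁻¹' {x} => g (-(y : E)) := by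
  obtain ⟨M, -, h⟩ := exists_tsum_weight_le x
  refine Summable.of_norm_bounded ((h f hf).1.mul_left C) fun y => ?_
  rw [← weight_neg]
  exact hg _

theorem exists_norm_fiberSum_le (x : X.Space) {g : E → ℂ} {C : ℝ} (hC : 0 ≤ C)
    (hg : ∀ y, ‖g y‖ ≤ C * weight y) :
    ∃ K : ℝ, 0 ≤ K ∧ ∀ f : C(E, X.Space), IsTiled f → ‖fiberSum x g f‖ ≤ K := by
  obtain ⟨M, hM, h⟩ := exists_tsum_weight_le x
  refine ⟨C * M, by positivity, fun f hf => ?_⟩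
  obtain ⟨h1, h2⟩ := h f hf
  refine (tsum_of_norm_bounded (h1.hasSum.mul_left C) fun y => ?_).trans
    (mul_le_mul_of_nonneg_left h2 hC)
  rw [← weight_neg]
  exact hg _

theorem IsTiled.countable_fiber {f : C(E, X.Space)} (hf : IsTiled f) (x : X.Space) :
    Countable (f ⁻¹' {x}) := by
  obtain ⟨M, -, h⟩ := exists_tsum_weight_le x
  have := (h f hf).1.countable_support
  have huniv : (Function.support fun y : f ⁻¹' {x} => weight (y : E)) = Set.univ :=
    Set.eq_univ_of_forall fun y => (weight_pos (y : E)).ne'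
  rwa [huniv, Set.countable_univ_iff] at this

/-- For `t` in a unit ball the terms are dominated by a fixed multiple of the summable weight.
Continuity in `t` is half of the joint measurability needed for Fubini. -/
theorem IsTiled.continuous_fiberSum_translate {f : C(E, X.Space)} (hf : IsTiled f) (x : X.Space)
    {g : E → ℂ} (hgc : Continuous g) {C : ℝ} (hC : 0 ≤ C) (hg : ∀ y, ‖g y‖ ≤ C * weight y) :
    Continuous fun t => fiberSum x g (translate t f) := by
  simp only [fiberSum_translate]
  rw [continuous_iff_continuousAt]
  intro t₀
  obtain ⟨M, -, h⟩ := exists_tsum_weight_le x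
  have hon : ContinuousOn (fun t => fiberSum x (fun y => g (y - t)) f) (Metric.ball t₀ 1) := by
    refine continuousOn_tsum (fun y => by fun_prop)
      ((h f hf).1.mul_left (C * (1 + (‖t₀‖ + 1)) ^ (Module.finrank ℝ E + 1))) fun y t ht => ?_
    refine (hg _).trans ?_
    rw [mul_assoc]
    refine mul_le_mul_of_nonneg_left ?_ hC
    rw [← weight_neg (y : E)]
    refine weight_le (by positivity) ?_
    rw [sub_sub_cancel]
    rw [Metric.mem_ball, dist_eq_norm] at ht
    have := norm_le_norm_add_norm_sub' t t₀
    linarith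
  exact hon.continuousAt (Metric.ball_mem_nhds _ one_pos)

variable {f₀ : C(E, X.Space)} [MeasurableSpace (hull f₀)] [BorelSpace (hull f₀)]

/-- Semicontinuity is available for nonnegative summands only, hence the split into positive and
negative parts. -/
theorem measurable_tsum_fiber (h₀ : IsTiled f₀) (x : X.Space) {g : E → ℝ} (hgc : Continuous g)
    {C : ℝ} (hg : ∀ y, |g y| ≤ C * weight y) :
    Measurable fun f : hull f₀ => ∑' y : (f : C(E, X.Space)) ⁻¹' {x}, g y := by
  have key : ∀ f : hull f₀, ∑' y : (f : C(E, X.Space)) ⁻¹' {x}, g y =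
      (∑' y : (f : C(E, X.Space)) ⁻¹' {x}, ENNReal.ofReal (max (g y) 0)).toReal -
      (∑' y : (f : C(E, X.Space)) ⁻¹' {x}, ENNReal.ofReal (max (-g y) 0)).toReal := by
    intro f
    obtain ⟨M, -, h⟩ := exists_tsum_weight_le x
    have hs := ((h f (h₀.of_mem_hull f.2)).1.mul_left C)
    have hpos : ∀ u : E → ℝ, (∀ y, |u y| ≤ C * weight y) →
        Summable fun y : (f : C(E, X.Space)) ⁻¹' {x} => max (u y) 0 := fun u hu =>
      Summable.of_nonneg_of_le (fun _ => le_max_right _ _)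
        (fun y => max_le ((le_abs_self _).trans (hu y)) ((abs_nonneg _).trans (hu y))) hs
    have h1 := hpos g hg
    have h2 := hpos (fun y => -g y) fun y => by rw [abs_neg]; exact hg y
    rw [← ENNReal.ofReal_tsum_of_nonneg (fun _ => le_max_right _ _) h1,
      ← ENNReal.ofReal_tsum_of_nonneg (fun _ => le_max_right _ _) h2,
      ENNReal.toReal_ofReal (tsum_nonneg fun _ => le_max_right _ _),
      ENNReal.toReal_ofReal (tsum_nonneg fun _ => le_max_right _ _), ← h1.tsum_sub h2]
    refine tsum_congr fun y => ?_
    rcases le_total (g y) 0 with h | h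
    · rw [max_eq_right h, max_eq_left (neg_nonneg.2 h)]; ring
    · rw [max_eq_left h, max_eq_right (neg_nonpos.2 h)]; ring
  simp only [key]
  exact (lowerSemicontinuous_tsum_fiber h₀ x (g := fun y => ENNReal.ofReal (max (g y) 0))
      (ENNReal.continuous_ofReal.comp (by fun_prop))).measurable.ennreal_toReal.sub
    (lowerSemicontinuous_tsum_fiber h₀ x (g := fun y => ENNReal.ofReal (max (-g y) 0))
      (ENNReal.continuous_ofReal.comp (by fun_prop))).measurable.ennreal_toReal

theorem measurable_Gamma (h₀ : IsTiled f₀) (x : X.Space) (φ : 𝓢(E, ℂ)) :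
    Measurable fun f : hull f₀ => Gamma x φ f := by
  obtain ⟨C, hC, hφ⟩ := exists_norm_le_weight φ
  have hφc := φ.continuous
  have hs : ∀ f : hull f₀, Summable fun y : (f : C(E, X.Space)) ⁻¹' {x} => φ (-(y : E)) :=
    fun f => (h₀.of_mem_hull f.2).summable_fiber x hφ
  have hre : Measurable fun f : hull f₀ => (Gamma x φ f).re := by
    simp only [Gamma, Complex.re_tsum (hs _)]
    refine measurable_tsum_fiber (C := C) h₀ x (g := fun y => (φ (-y)).re) (by fun_prop) fun y => ?_
    rw [← weight_neg]
    exact (Complex.abs_re_le_norm _).trans (hφ _)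
  have him : Measurable fun f : hull f₀ => (Gamma x φ f).im := by
    simp only [Gamma, Complex.im_tsum (hs _)]
    refine measurable_tsum_fiber (C := C) h₀ x (g := fun y => (φ (-y)).im) (by fun_prop) fun y => ?_
    rw [← weight_neg]
    exact (Complex.abs_im_le_norm _).trans (hφ _)
  exact measurable_of_re_im (𝕜 := ℂ) hre him

theorem memLp_Gamma (h₀ : IsTiled f₀) (μ : Measure (hull f₀)) [IsProbabilityMeasure μ]
    (x : X.Space) (φ : 𝓢(E, ℂ)) : MemLp (Gamma x φ) 2 μ := by
  obtain ⟨C, hC, hφ⟩ := exists_norm_le_weight φ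
  obtain ⟨K, hK, h⟩ := exists_norm_fiberSum_le x hC hφ
  exact MemLp.of_bound (measurable_Gamma h₀ x φ).aestronglyMeasurable K
    (Filter.Eventually.of_forall fun f => h f (h₀.of_mem_hull f.2))

end Bound

/-! ### Coefficients against an eigenfunction -/

section Amplitude

section Coeff

variable {f₀ : C(E, X.Space)} [MeasurableSpace (hull f₀)]

/-- The coefficient `⟨ψ, Γ_x(φ)⟩`, as an integral. -/
def coeff (μ : Measure (hull f₀)) (ψ : Lp ℂ 2 μ) (x : X.Space) (φ : 𝓢(E, ℂ)) : ℂ :=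
  ∫ f, Gamma x φ f * star (ψ f) ∂μ

theorem inner_toLp_Gamma (μ : Measure (hull f₀)) (ψ : Lp ℂ 2 μ) (x : X.Space) (φ : 𝓢(E, ℂ))
    (h : MemLp (Gamma x φ) 2 μ) : inner ℂ ψ (h.toLp (Gamma x φ)) = coeff μ ψ x φ := by
  rw [L2.inner_def, coeff]
  refine integral_congr_ae ?_
  filter_upwards [h.coeFn_toLp] with f hf
  rw [hf, RCLike.inner_apply]
  rfl

end Coeff

variable [MeasurableSpace E] [BorelSpace E]
  {f₀ : C(E, X.Space)} [MeasurableSpace (hull f₀)] [BorelSpace (hull f₀)]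

/-- Substituting `T_{-t}` moves the translation onto `ψ`, and conjugating the eigenvalue gives the
minus sign. -/
theorem integral_Gamma_translate (h₀ : IsTiled f₀) {μ : Measure (hull f₀)}
    (hμ : ∀ t : E, MeasurePreserving (hullTranslate t) μ μ) {k : StrongDual ℝ E} {ψ : Lp ℂ 2 μ}
    (hψ : IsEigenfunction μ k ψ) (x : X.Space) (φ : 𝓢(E, ℂ)) (t : E) :
    ∫ f, Gamma x φ (hullTranslate t f) * star (ψ f) ∂μ =
      Complex.exp (-(2 * Real.pi * Complex.I * (k t : ℂ))) * coeff μ ψ x φ := by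
  have hm : AEStronglyMeasurable
      (fun f => Gamma x φ (hullTranslate t f) * star (ψ f)) μ := by
    refine AEStronglyMeasurable.mul ?_ ?_
    · exact ((measurable_Gamma h₀ x φ).comp (hμ t).measurable).aestronglyMeasurable
    · exact (continuous_star.comp_aestronglyMeasurable (Lp.aestronglyMeasurable ψ))
  have h1 := integral_map (hμ (-t)).measurable.aemeasurable
    (f := fun f => Gamma x φ (hullTranslate t f) * star (ψ f)) (by rwa [(hμ (-t)).map_eq])
  rw [(hμ (-t)).map_eq] at h1
  rw [h1, coeff, ← integral_const_mul]
  refine integral_congr_ae ?_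
  filter_upwards [hψ t] with f hf
  have h2 : hullTranslate t (hullTranslate (-t) f) = f := by
    apply Subtype.ext
    ext y
    simp [hullTranslate, translate]
  rw [hf, h2, star_mul']
  have h3 : star (Complex.exp (2 * Real.pi * Complex.I * (k t : ℂ))) =
      Complex.exp (-(2 * Real.pi * Complex.I * (k t : ℂ))) := by
    rw [Complex.star_def, ← Complex.exp_conj]
    simp [Complex.conj_ofNat]
  rw [h3]
  ring

/-- Averaging translates against `φ` replaces `χ` by the convolution of `φ` and `χ`, evaluated at
the points `-y`. -/
theorem IsTiled.integral_mul_fiberSum {f : C(E, X.Space)} (hf : IsTiled f) (x : X.Space)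
    (φ χ : 𝓢(E, ℂ)) : ∫ t, φ t * fiberSum x χ (translate t f) =
      ∑' y : f ⁻¹' {x}, ∫ t, φ t * χ (-(y : E) - t) := by
  have := hf.countable_fiber x
  obtain ⟨M, -, hM⟩ := exists_tsum_weight_le x
  obtain ⟨C, hC, hφ⟩ := exists_norm_le_weight_sq φ
  obtain ⟨C', hC', hχ⟩ := exists_norm_le_weight χ
  have hχc := χ.continuous
  have hint : ∀ y : E, Integrable fun t => φ t * χ (-y - t) := fun y =>
    φ.integrable.mul_bdd (c := C') (by fun_prop : Continuous fun t => χ (-y - t)).aestronglyMeasurable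
      (Filter.Eventually.of_forall fun t => (hχ _).trans
        (mul_le_of_le_one_right hC' (weight_le_one _)))
  rw [integral_tsum_of_summable_integral_norm (fun y : f ⁻¹' {x} => hint y)]
  · simp only [fiberSum_translate]
    simp only [fiberSum, tsum_mul_left]
  refine Summable.of_nonneg_of_le (fun y => integral_nonneg fun t => norm_nonneg _) (fun y => ?_)
    ((hM f hf).1.mul_left (C * C' * ∫ t : E, weight t))
  have hb : ∀ t : E, ‖φ t * χ (-(y : E) - t)‖ ≤ C * C' * weight (y : E) * weight t := by
    intro t
    -- One factor `weight t` pays for the shift by `t`; the other remains to be integrated.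
    have h1 : weight (-(y : E) - t) * weight t ≤ weight (y : E) := by
      have := weight_le (y := -(y : E) - t) (z := -(y : E)) (norm_nonneg t) (by
        rw [sub_sub_cancel])
      rw [weight_neg] at this
      refine (mul_le_mul_of_nonneg_right this (weight_pos t).le).trans_eq ?_
      rw [mul_right_comm, weight, mul_inv_cancel₀ (by positivity), one_mul]
    have h2 := mul_nonneg (mul_nonneg hC hC') (weight_pos t).le
    calc ‖φ t * χ (-(y : E) - t)‖ ≤ C * (weight t * weight t) * (C' * weight (-(y : E) - t)) := by
          rw [norm_mul]
          exact mul_le_mul (hφ t) (hχ _) (norm_nonneg _)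
            (mul_nonneg hC (mul_nonneg (weight_pos t).le (weight_pos t).le))
      _ = C * C' * weight t * (weight (-(y : E) - t) * weight t) := by ring
      _ ≤ C * C' * weight t * weight (y : E) := mul_le_mul_of_nonneg_left h1 h2
      _ = _ := by ring
  calc ∫ t, ‖φ t * χ (-(y : E) - t)‖ ≤ ∫ t, C * C' * weight (y : E) * weight t :=
        integral_mono (hint y).norm (integrable_weight.const_mul _) hb
    _ = _ := by rw [integral_const_mul]; ring

theorem IsTiled.integral_mul_fiberSum_comm {f : C(E, X.Space)} (hf : IsTiled f) (x : X.Space)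
    (φ χ : 𝓢(E, ℂ)) : ∫ t, φ t * fiberSum x χ (translate t f) =
      ∫ t, χ t * fiberSum x φ (translate t f) := by
  rw [hf.integral_mul_fiberSum, hf.integral_mul_fiberSum]
  refine tsum_congr fun y => ?_
  rw [← integral_sub_left_eq_self _ volume (-(y : E))]
  refine integral_congr_ae (Filter.Eventually.of_forall fun t => ?_)
  dsimp only
  rw [sub_sub_cancel, mul_comm]

theorem fourierAt_mul_coeff (h₀ : IsTiled f₀) {μ : Measure (hull f₀)} [IsProbabilityMeasure μ]
    (hμ : ∀ t : E, MeasurePreserving (hullTranslate t) μ μ) {k : StrongDual ℝ E} {ψ : Lp ℂ 2 μ}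
    (hψ : IsEigenfunction μ k ψ) (x : X.Space) (φ χ : 𝓢(E, ℂ)) :
    fourierAt φ k * coeff μ ψ x χ =
      ∫ f, (∫ t, φ t * fiberSum x χ (translate t (f : C(E, X.Space)))) * star (ψ f) ∂μ := by
  obtain ⟨C, hC, hχ⟩ := exists_norm_le_weight χ
  obtain ⟨K, hK, hbound⟩ := exists_norm_fiberSum_le x hC hχ
  -- Continuity in `t` and measurability in `f` give joint measurability.
  have hmeas : StronglyMeasurable (Function.uncurry fun (t : E) (f : hull f₀) =>
      Gamma x χ (hullTranslate t f)) := by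
    refine stronglyMeasurable_uncurry_of_continuous_of_stronglyMeasurable (fun f => ?_) fun t => ?_
    · exact (h₀.of_mem_hull f.2).continuous_fiberSum_translate x χ.continuous hC hχ
    · exact ((measurable_Gamma h₀ x χ).comp (hμ t).measurable).stronglyMeasurable
  have hψint : Integrable (fun f => star (ψ f)) μ := by
    have h1 : Integrable ψ μ := (Lp.memLp ψ).integrable (by norm_num)
    exact h1.norm.mono' (continuous_star.comp_aestronglyMeasurable h1.1)
      (Filter.Eventually.of_forall fun f => by simp)
  have hint : Integrable (Function.uncurry fun (t : E) (f : hull f₀) =>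
      φ t * star (ψ f) * Gamma x χ (hullTranslate t f)) (volume.prod μ) :=
    (φ.integrable.mul_prod hψint).mul_bdd (c := K) hmeas.aestronglyMeasurable
      (Filter.Eventually.of_forall fun z =>
        hbound _ (h₀.of_mem_hull (hullTranslate z.1 z.2).2))
  have hswap := integral_integral_swap hint
  calc fourierAt φ k * coeff μ ψ x χ
      = ∫ t, ∫ f, φ t * star (ψ f) * Gamma x χ (hullTranslate t f) ∂μ := by
        rw [fourierAt, ← integral_mul_const]
        refine integral_congr_ae (Filter.Eventually.of_forall fun t => ?_)
        dsimp only
        rw [mul_assoc, ← integral_Gamma_translate h₀ hμ hψ, ← integral_const_mul]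
        exact integral_congr_ae (Filter.Eventually.of_forall fun f => by dsimp only; ring)
    _ = _ := by
        rw [hswap]
        refine integral_congr_ae (Filter.Eventually.of_forall fun f => ?_)
        dsimp only
        rw [← integral_mul_const]
        exact integral_congr_ae (Filter.Eventually.of_forall fun t => by
          dsimp only
          rw [mul_right_comm]
          rfl)

theorem fourierAt_mul_coeff_comm (h₀ : IsTiled f₀) {μ : Measure (hull f₀)}
    [IsProbabilityMeasure μ] (hμ : ∀ t : E, MeasurePreserving (hullTranslate t) μ μ)
    {k : StrongDual ℝ E} {ψ : Lp ℂ 2 μ} (hψ : IsEigenfunction μ k ψ) (x : X.Space)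
    (φ χ : 𝓢(E, ℂ)) : fourierAt φ k * coeff μ ψ x χ = fourierAt χ k * coeff μ ψ x φ := by
  rw [fourierAt_mul_coeff h₀ hμ hψ, fourierAt_mul_coeff h₀ hμ hψ]
  refine integral_congr_ae (Filter.Eventually.of_forall fun f => ?_)
  dsimp only
  rw [(h₀.of_mem_hull f.2).integral_mul_fiberSum_comm]

theorem coeff_openCell (h₀ : IsTiled f₀) {μ : Measure (hull f₀)}
    (hμ : ∀ t : E, MeasurePreserving (hullTranslate t) μ μ)
    {k : StrongDual ℝ E} {ψ : Lp ℂ 2 μ} (hψ : IsEigenfunction μ k ψ) {n : ℕ} (s : X.B.cell n)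
    {x x' : X.Space} (hx : x ∈ openCell s) (hx' : x' ∈ openCell s) (φ : 𝓢(E, ℂ)) :
    coeff μ ψ x' φ = Complex.exp (-(2 * Real.pi * Complex.I *
      (k (alpha s x' - alpha s x) : ℂ))) * coeff μ ψ x φ := by
  rw [← integral_Gamma_translate h₀ hμ hψ, coeff]
  refine integral_congr_ae (Filter.Eventually.of_forall fun f => ?_)
  dsimp only
  rw [Gamma_eq_fiberSum, (h₀.of_mem_hull f.2).fiberSum_openCell s hx hx']
  rfl

end Amplitude

end FBSComplex

/-! ### Bumps in Fourier space and the diffraction embedding -/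

namespace FBSComplex

open SemiSimplicialSet
open scoped FourierTransform

/-- Some power `(1 + ‖x‖)^(-n)` is integrable and bounded below on the ball, so Markov's inequality
applies. -/
theorem measure_closedBall_lt_top {V : Type*} [NormedAddCommGroup V] [MeasurableSpace V]
    {ν : Measure V} (hν : ν.HasTemperateGrowth) (c : V) (R : ℝ) :
    ν (Metric.closedBall c R) < ⊤ := by
  obtain ⟨n, hn⟩ := hν.exists_integrable
  have hpos : (0 : ℝ) < (1 + (‖c‖ + |R|)) ^ (-(n : ℝ)) := by positivity
  refine (measure_mono fun x hx => ?_).trans_lt (hn.measure_norm_ge_lt_top hpos)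
  rw [Metric.mem_closedBall, dist_eq_norm] at hx
  have h1 := norm_le_norm_add_norm_sub' x c
  have h2 := le_abs_self R
  rw [Set.mem_ofPred_eq, Real.norm_of_nonneg (by positivity)]
  exact Real.rpow_le_rpow_of_nonpos (by positivity) (by linarith) (by simp)

section Tensor

variable {E : Type v} [NormedAddCommGroup E] [InnerProductSpace ℝ E] {m : ℕ}

theorem measurable_tensorBasis {u : StrongDual ℝ E → ℂ} (hu : Measurable u) (p : Fin m) :
    Measurable (tensorBasis u p) := by
  classical
  refine measurable_pi_lambda _ fun q => ?_
  by_cases h : q = p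
  · subst h; simpa [tensorBasis] using hu
  · simp [tensorBasis, h]

theorem tensorBasis_sub (u u' : StrongDual ℝ E → ℂ) (p : Fin m) :
    tensorBasis u p - tensorBasis u' p = tensorBasis (u - u') p := by
  funext ξ
  exact (Pi.single_sub p _ _).symm

end Tensor

section Diffraction

variable {E : Type v} [NormedAddCommGroup E] [InnerProductSpace ℝ E] [FiniteDimensional ℝ E] {m : ℕ}
  (ζ : MatrixMeasure E m)

theorem form_tensorBasis (u : StrongDual ℝ E → ℂ) (p : Fin m) (ξ : StrongDual ℝ E) :
    ζ.form (tensorBasis u p) (tensorBasis u p) ξ = star (u ξ) * u ξ * ζ.density ξ p p := by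
  classical
  simp only [MatrixMeasure.form, tensorBasis, ← Pi.single_star, single_dotProduct,
    Matrix.mulVec_single]
  simp
  ring

/-- The diagonal entries are nonnegative and sum to the trace, which is one. -/
theorem norm_density_le : ∀ᵐ ξ ∂ζ.base, ∀ p, ‖ζ.density ξ p p‖ ≤ 1 := by
  filter_upwards [ζ.trace_eq_one] with ξ hξ p
  have hpos := fun i => (ζ.posSemidef ξ).diag_nonneg (i := i)
  have hle : ζ.density ξ p p ≤ 1 := by
    rw [← hξ, Matrix.trace]
    exact Finset.single_le_sum (f := fun i => ζ.density ξ i i) (fun i _ => hpos i)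
      (Finset.mem_univ p)
  rw [← Complex.norm_of_nonneg' (hpos p)] at hle
  exact_mod_cast hle

theorem tensorBasis_mem_L2 {u : StrongDual ℝ E → ℂ} (hu : Measurable u) {C : ℝ}
    (hC : ∀ ξ, ‖u ξ‖ ≤ C) {S : Set (StrongDual ℝ E)} (hS : ζ.base S ≠ ⊤)
    (hSm : MeasurableSet S) (h0 : ∀ ξ ∉ S, u ξ = 0) (p : Fin m) : tensorBasis u p ∈ ζ.L2 := by
  have hm := measurable_tensorBasis hu p
  refine ⟨hm, Integrable.mono' (g := S.indicator fun _ => C * C)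
    ((integrable_indicator_iff hSm).2 (integrableOn_const hS))
    (ζ.measurable_form hm hm).aestronglyMeasurable ?_⟩
  filter_upwards [norm_density_le ζ] with ξ hξ
  rw [form_tensorBasis, norm_mul, norm_mul, norm_star]
  by_cases h : ξ ∈ S
  · rw [Set.indicator_of_mem h]
    have h1 := mul_le_mul (hC ξ) (hC ξ) (norm_nonneg _) ((norm_nonneg _).trans (hC ξ))
    exact (mul_le_of_le_one_right (by positivity) (hξ p)).trans h1
  · rw [Set.indicator_of_notMem h, h0 ξ h]
    simp

end Diffraction

section Cells

variable {E : Type v} [NormedAddCommGroup E] [InnerProductSpace ℝ E] [FiniteDimensional ℝ E]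
  {X : FBSComplex.{u, v} E}

theorem mem_FTotal_of_exp {k : StrongDual ℝ E} {a : X.Space → ℂ}
    (h : ∀ (n : ℕ) (s : X.B.cell n), ∃ c : ℂ, ∀ y ∈ openCell s,
      a y = c * Complex.exp (-(2 * Real.pi * Complex.I * (k (alpha s y) : ℂ)))) :
    a ∈ FTotal X k := by
  classical
  choose c hc using h
  have := Fintype.ofFinite (Σ n, X.B.cell n)
  have ha : a = ∑ z : (Σ n, X.B.cell n), c z.1 z.2 • Y k z.2 := by
    funext y
    obtain ⟨n, s, hs⟩ := exists_mem_openCell y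
    rw [Finset.sum_apply, Finset.sum_eq_single (⟨n, s⟩ : Σ n, X.B.cell n)]
    · rw [hc n s y hs, Pi.smul_apply, Y, if_pos hs, smul_eq_mul]
    · rintro ⟨n', s'⟩ - hne
      rw [Pi.smul_apply, Y, if_neg fun hs' => hne (eq_of_mem_openCell hs' hs), smul_zero]
    · exact fun h => absurd (Finset.mem_univ _) h
  rw [ha]
  refine Submodule.sum_mem _ fun z _ => Submodule.smul_mem _ _ ?_
  have hz : ¬ Module.finrank ℝ E < z.1 := fun h => (X.isEmpty_above z.1 h).false z.2
  exact Submodule.mem_iSup_of_mem (⟨z.1, by omega⟩ : Fin (Module.finrank ℝ E + 1))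
    (Submodule.subset_span ⟨z.2, rfl⟩)

end Cells

variable {E : Type v} [NormedAddCommGroup E] [InnerProductSpace ℝ E] [FiniteDimensional ℝ E]
  [MeasurableSpace E] [BorelSpace E]

theorem fourierAt_eq_fourier (φ : 𝓢(E, ℂ)) (ξ : StrongDual ℝ E) :
    fourierAt φ ξ = 𝓕 φ ((InnerProductSpace.toDual ℝ E).symm ξ) := by
  rw [SchwartzMap.fourier_coe, Real.fourier_eq', fourierAt]
  refine integral_congr_ae (Filter.Eventually.of_forall fun y => ?_)
  dsimp only
  rw [real_inner_comm, InnerProductSpace.toDual_symm_apply, smul_eq_mul, mul_comm]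
  congr 2
  push_cast
  ring

theorem continuous_fourierAt (φ : 𝓢(E, ℂ)) : Continuous fun ξ => fourierAt φ ξ := by
  simp only [fourierAt_eq_fourier]
  exact (𝓕 φ).continuous.comp (LinearIsometryEquiv.continuous _)

/-- Schwartz functions whose Fourier transforms are bumps around `k`. -/
theorem exists_fourierAt_bump (k : StrongDual ℝ E) {ε : ℝ} (hε : 0 < ε) :
    ∃ φ : 𝓢(E, ℂ), fourierAt φ k = 1 ∧ (∀ ξ, ‖fourierAt φ ξ‖ ≤ 1) ∧
      ∀ ξ, ε ≤ ‖ξ - k‖ → fourierAt φ ξ = 0 := by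
  let D := (InnerProductSpace.toDual ℝ E).symm
  let b : ContDiffBump (D k) := ⟨ε / 2, ε, by positivity, by linarith⟩
  have hsupp : HasCompactSupport fun y => (b y : ℂ) :=
    b.hasCompactSupport.comp_left Complex.ofReal_zero
  have hsmooth : ContDiff ℝ (⊤ : ℕ∞) fun y => (b y : ℂ) :=
    Complex.ofRealCLM.contDiff.comp b.contDiff
  let u : 𝓢(E, ℂ) := hsupp.toSchwartzMap hsmooth
  have hu : ∀ ξ, fourierAt (𝓕⁻ u) ξ = (b (D ξ) : ℂ) := fun ξ => by
    rw [fourierAt_eq_fourier, FourierTransform.fourier_fourierInv_eq]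
    rfl
  refine ⟨𝓕⁻ u, ?_, fun ξ => ?_, fun ξ hξ => ?_⟩
  · rw [hu, b.one_of_mem_closedBall (Metric.mem_closedBall_self b.rIn_pos.le), Complex.ofReal_one]
  · rw [hu, Complex.norm_real, Real.norm_of_nonneg b.nonneg]
    exact b.le_one
  · rw [hu, b.zero_of_le_dist, Complex.ofReal_zero]
    rw [dist_eq_norm, ← map_sub, LinearIsometryEquiv.norm_map]
    exact hξ

variable {X : FBSComplex.{u, v} E} {f₀ : C(E, X.Space)} [MeasurableSpace (hull f₀)]

/-- Bumps with value 1 at `k` have images with coefficient exactly `a (x p)`, and they converge to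
the indicator of `k` in `L²(ζ)`; the isometry `Θ` carries this to the limit. -/
theorem IsPartialAmplitude.inner_embedding {μ : Measure (hull f₀)}
    {k : StrongDual ℝ E} {ψ : Lp ℂ 2 μ} {a : X.Space → ℂ} (ha : IsPartialAmplitude μ k ψ a)
    {m : ℕ} {x : Fin m → X.Space} {ζ : MatrixMeasure E m} {Θ : ζ.L2 →ₗ[ℂ] Lp ℂ 2 μ}
    (hΘ : IsDiffractionEmbedding μ x ζ Θ) (p : Fin m) :
    ∃ h : tensorBasis (({k} : Set (StrongDual ℝ E)).indicator 1) p ∈ ζ.L2,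
      inner ℂ ψ (Θ ⟨_, h⟩) = a (x p) := by
  have hfin : ∀ S : Set (StrongDual ℝ E), S ⊆ Metric.closedBall k 1 → ζ.base S ≠ ⊤ := fun S hS =>
    ((measure_mono hS).trans_lt (measure_closedBall_lt_top ζ.temperate k 1)).ne
  let e : StrongDual ℝ E → ℂ := ({k} : Set (StrongDual ℝ E)).indicator 1
  have hem : Measurable e := measurable_one.indicator (measurableSet_singleton k)
  have he : tensorBasis e p ∈ ζ.L2 := by
    refine tensorBasis_mem_L2 ζ hem (C := 1) (fun ξ => ?_)
      (hfin {k} (by simp)) (measurableSet_singleton k) (fun ξ hξ => Set.indicator_of_notMem hξ _) p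
    by_cases h : ξ ∈ ({k} : Set (StrongDual ℝ E)) <;> simp [e, h]
  refine ⟨he, ?_⟩
  let ε : ℕ → ℝ := fun n => 1 / ((n : ℝ) + 1)
  have hε : ∀ n, 0 < ε n := fun n => by positivity
  have hε1 : ∀ n, ε n ≤ 1 := fun n => by
    rw [div_le_one (by positivity)]
    simp
  have hεt : Filter.Tendsto ε Filter.atTop (nhds 0) := tendsto_one_div_add_atTop_nhds_zero_nat
  choose φ hφk hφ1 hφ0 using fun n => exists_fourierAt_bump k (hε n)
  have hφm : ∀ n, Measurable fun ξ => fourierAt (φ n) ξ := fun n =>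
    (continuous_fourierAt (φ n)).measurable
  have hφ0' : ∀ n, ∀ ξ ∉ Metric.closedBall k 1, fourierAt (φ n) ξ = 0 := fun n ξ hξ => by
    refine hφ0 n ξ ((hε1 n).trans ?_)
    rw [Metric.mem_closedBall, dist_eq_norm, not_le] at hξ
    exact hξ.le
  have hmem : ∀ n, tensorBasis (fourierAt (φ n)) p ∈ ζ.L2 := fun n =>
    tensorBasis_mem_L2 ζ (hφm n) (hφ1 n) (hfin _ subset_rfl) measurableSet_closedBall (hφ0' n) p
  have hval : ∀ n, inner ℂ ψ (Θ ⟨_, hmem n⟩) = a (x p) := fun n => by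
    obtain ⟨h, h1⟩ := ha (x p) (φ n)
    rw [hφk n, mul_one] at h1
    rw [← h1]
    congr 1
    exact Lp.ext ((hΘ.map_schwartz (φ n) p (hmem n)).trans h.coeFn_toLp.symm)
  have hnorm : ∀ n, inner ℂ (Θ ⟨_, hmem n⟩ - Θ ⟨_, he⟩) (Θ ⟨_, hmem n⟩ - Θ ⟨_, he⟩) =
      ∫ ξ, star (fourierAt (φ n) ξ - e ξ) * (fourierAt (φ n) ξ - e ξ) * ζ.density ξ p p
        ∂ζ.base := fun n => by
    rw [← map_sub, hΘ.inner_map, MatrixMeasure.innerL2]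
    refine integral_congr_ae (Filter.Eventually.of_forall fun ξ => ?_)
    have := tensorBasis_sub (fourierAt (φ n)) e p
    change ζ.form (tensorBasis (fourierAt (φ n)) p - tensorBasis e p)
      (tensorBasis (fourierAt (φ n)) p - tensorBasis e p) ξ = _
    rw [this, form_tensorBasis]
    rfl
  -- Dominated convergence: the difference is at most 2 in modulus, vanishes off the unit ball, and
  -- at each `ξ` is eventually zero.
  have hlim : Filter.Tendsto (fun n => inner ℂ (Θ ⟨_, hmem n⟩ - Θ ⟨_, he⟩)
      (Θ ⟨_, hmem n⟩ - Θ ⟨_, he⟩)) Filter.atTop (nhds (∫ _, (0 : ℂ) ∂ζ.base)) := by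
    simp only [hnorm]
    refine tendsto_integral_of_dominated_convergence
      ((Metric.closedBall k 1).indicator fun _ => (2 * 2 : ℝ)) (fun n => ?_)
      ((integrable_indicator_iff measurableSet_closedBall).2
        (integrableOn_const (hfin _ subset_rfl))) (fun n => ?_) ?_
    · refine Measurable.aestronglyMeasurable (Measurable.mul (Measurable.mul ?_ ?_)
        (ζ.measurable_density p p))
      · exact continuous_star.measurable.comp ((hφm n).sub hem)
      · exact (hφm n).sub hem
    · filter_upwards [norm_density_le ζ] with ξ hξ
      rw [norm_mul, norm_mul, norm_star]
      by_cases h : ξ ∈ Metric.closedBall k 1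
      · rw [Set.indicator_of_mem h]
        have he1 : ‖e ξ‖ ≤ 1 := by
          by_cases h : ξ ∈ ({k} : Set (StrongDual ℝ E)) <;> simp [e, h]
        have h2 : ‖fourierAt (φ n) ξ - e ξ‖ ≤ 2 :=
          (norm_sub_le _ _).trans ((add_le_add (hφ1 n ξ) he1).trans_eq one_add_one_eq_two)
        exact (mul_le_of_le_one_right (by positivity) (hξ p)).trans
          (mul_le_mul h2 h2 (norm_nonneg _) zero_le_two)
      · have hk : ξ ∉ ({k} : Set (StrongDual ℝ E)) := fun hk => h (by
          rw [Set.mem_singleton_iff.1 hk]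
          exact Metric.mem_closedBall_self zero_le_one)
        rw [Set.indicator_of_notMem h, hφ0' n ξ h, show e ξ = 0 from Set.indicator_of_notMem hk _]
        simp
    · refine Filter.Eventually.of_forall fun ξ => ?_
      refine tendsto_const_nhds.congr' ?_
      by_cases h : ξ = k
      · refine Filter.Eventually.of_forall fun n => ?_
        subst h
        simp [hφk n, e]
      · have hpos : 0 < ‖ξ - k‖ := norm_pos_iff.2 (sub_ne_zero.2 h)
        filter_upwards [hεt.eventually (gt_mem_nhds hpos)] with n hn
        rw [hφ0 n ξ hn.le, show e ξ = 0 from Set.indicator_of_notMem (by simpa using h) _]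
        simp
  rw [integral_zero] at hlim
  have hlim' : Filter.Tendsto (fun n => ‖Θ ⟨_, hmem n⟩ - Θ ⟨_, he⟩‖ ^ 2) Filter.atTop (nhds 0) := by
    have h1 := hlim.norm
    simp only [norm_zero] at h1
    refine h1.congr fun n => ?_
    rw [inner_self_eq_norm_sq_to_K]
    simp
  have hlim'' : Filter.Tendsto (fun n => ‖Θ ⟨_, hmem n⟩ - Θ ⟨_, he⟩‖) Filter.atTop (nhds 0) := by
    have h1 := hlim'.sqrt
    simpa [Real.sqrt_sq (norm_nonneg _)] using h1
  have htend : Filter.Tendsto (fun n => Θ ⟨_, hmem n⟩) Filter.atTop (nhds (Θ ⟨_, he⟩)) :=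
    tendsto_iff_norm_sub_tendsto_zero.2 hlim''
  have hfinal := (tendsto_const_nhds (x := ψ)).inner htend (𝕜 := ℂ)
  simp only [hval] at hfinal
  exact tendsto_nhds_unique tendsto_const_nhds hfinal |>.symm

theorem exists_fourierAt_eq_one (k : StrongDual ℝ E) : ∃ χ : 𝓢(E, ℂ), fourierAt χ k = 1 := by
  obtain ⟨χ, h, -⟩ := exists_fourierAt_bump k one_pos
  exact ⟨χ, h⟩

theorem IsPartialAmplitude.eq_coeff {μ : Measure (hull f₀)} {k : StrongDual ℝ E} {ψ : Lp ℂ 2 μ}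
    {a : X.Space → ℂ} (ha : IsPartialAmplitude μ k ψ a) {χ : 𝓢(E, ℂ)} (hχ : fourierAt χ k = 1)
    (x : X.Space) : a x = coeff μ ψ x χ := by
  obtain ⟨h, h1⟩ := ha x χ
  rw [inner_toLp_Gamma, hχ, mul_one] at h1
  exact h1.symm

end FBSComplex

end

theorem mainTheorem7 {E : Type v} [NormedAddCommGroup E] [InnerProductSpace ℝ E]
    [FiniteDimensional ℝ E] [MeasurableSpace E] [BorelSpace E] (X : FBSComplex.{u, v} E)
    (f₀ : C(E, X.Space)) (hf₀ : FBSComplex.IsIsometricWinding f₀)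
    [MeasurableSpace (FBSComplex.hull f₀)] [BorelSpace (FBSComplex.hull f₀)]
    (μ : Measure (FBSComplex.hull f₀)) [IsProbabilityMeasure μ]
    (hμ : ∀ t : E, MeasurePreserving (FBSComplex.hullTranslate t) μ μ)
    (k : StrongDual ℝ E) (hk : k ∈ FBSComplex.pointSpectrum μ)
    (ψ : Lp ℂ 2 μ) (hψ : FBSComplex.IsEigenfunction μ k ψ) (hψ_norm : ‖ψ‖ = 1) :
    (∃! a : X.Space → ℂ, FBSComplex.IsPartialAmplitude μ k ψ a) ∧
    ∀ a : X.Space → ℂ, FBSComplex.IsPartialAmplitude μ k ψ a →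
      (∀ (m : ℕ) (x : Fin m → X.Space) (ζ : MatrixMeasure E m) (Θ : ζ.L2 →ₗ[ℂ] Lp ℂ 2 μ),
        FBSComplex.IsDiffractionMeasure μ x ζ → FBSComplex.IsDiffractionEmbedding μ x ζ Θ →
        ∀ p : Fin m, ∃ h :
          FBSComplex.tensorBasis (({k} : Set (StrongDual ℝ E)).indicator 1) p ∈ ζ.L2,
          inner ℂ ψ (Θ ⟨_, h⟩) = a (x p)) ∧
      a ∈ FBSComplex.FTotal X k ∧
      ∀ (n : ℕ) (s : X.B.cell n), ∃ c : ℂ, ∀ y ∈ SemiSimplicialSet.openCell s,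
        a y = c * Complex.exp (-(2 * Real.pi * Complex.I * (k (FBSComplex.alpha s y) : ℂ))) := by
  have h₀ := hf₀.isTiled
  obtain ⟨χ, hχ⟩ := FBSComplex.exists_fourierAt_eq_one k
  refine ⟨⟨fun x => FBSComplex.coeff μ ψ x χ, fun x φ => ?_, fun a ha => ?_⟩, fun a ha => ?_⟩
  · have hL := FBSComplex.memLp_Gamma h₀ μ x φ
    refine ⟨hL, ?_⟩
    rw [FBSComplex.inner_toLp_Gamma]
    have := FBSComplex.fourierAt_mul_coeff_comm h₀ hμ hψ x χ φ
    rw [hχ, one_mul] at this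
    rw [this, mul_comm]
  · exact funext fun x => ha.eq_coeff hχ x
  have hcell : ∀ (n : ℕ) (s : X.B.cell n), ∃ c : ℂ, ∀ y ∈ SemiSimplicialSet.openCell s,
      a y = c * Complex.exp (-(2 * Real.pi * Complex.I * (k (FBSComplex.alpha s y) : ℂ))) := by
    intro n s
    -- The barycenter is the reference point at which the constant `c` is read off.
    let z : X.Space := SemiSimplicialSet.charMap s stdSimplex.barycenter
    have hz : z ∈ SemiSimplicialSet.openCell s :=
      ⟨_, SemiSimplicialSet.barycenter_mem_openSimplex n, rfl⟩
    refine ⟨a z * Complex.exp (2 * Real.pi * Complex.I * (k (FBSComplex.alpha s z) : ℂ)),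
      fun y hy => ?_⟩
    rw [ha.eq_coeff hχ y, FBSComplex.coeff_openCell h₀ hμ hψ s hz hy, ← ha.eq_coeff hχ z,
      mul_comm, mul_assoc (a z), ← Complex.exp_add]
    congr 2
    rw [map_sub]
    push_cast
    ring
  exact ⟨fun m x ζ Θ _ hΘ p => ha.inner_embedding hΘ p, FBSComplex.mem_FTotal_of_exp hcell, hcell⟩
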